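/- **Setting.** Let $K\ge 2$, let $\nu_1,\dots,\nu_K$ be probability distributions on $[0,1]$ with means $0<\mu_K\le\dots\le\mu_2<\mu_1<1$, let $\Delta_k=\mu_1-\mu_k$, and for each $k$ let $X_{k,1},X_{k,2},\dots$ be i.i.d. with law $\nu_k$. At each time $t=1,2,\dots$ a leader broadcasts an arm $A_t$, which is a function of the bits received so far from each arm; follower $A_t$ pulls its arm for the $s$-th time, $s=T_{A_t}(t)$, observes $X_{A_t,s}$ and sends back a bit $M_{A_t,s}$ that depends on $X_{A_t,1},\dots,X_{A_t,s}$. Here $T_k(n)=|\{t\le n:A_t=k\}|$. The regret is $R_n=\sum_{t=1}^n\mathbb E[\mu_1-\mu_{A_t}]=\sum_{k=2}^K\Delta_k\,\mathbb E[T_k(n)]$. **Message policy $\pi^m$.** For integers $i,s\ge 0$ let $\tau(i)=1+(i+1)\lceil\log_2(i+1)\rceil-2^{\lceil\log_2(i+1)\rceil}$ and $\iota(s)=\max\{i\ge 0:\tau(i)\le s\}$. For integers $\alpha\ge0$ let $\Gamma_\alpha(x)=\lceil 2^\alpha x\rceil-1$ for $x\in(0,1]$ and $\Gamma_\alpha(0)=0$.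 Let $\hat\mu_{k,m}=\frac1m\sum_{i=1}^m X_{k,i}$. The $s$-th message of follower $k$ is, with $a=\tau(\iota(s-1))$, $$M_{k,s}=\Gamma_{s-a}(\hat\mu_{k,1+a})-2\,\Gamma_{s-a-1}(\hat\mu_{k,1+a})\in\{0,1\}.$$ **Arm policy $\pi^a(g)$.** For $s\ge1$ let $\eta(s)=1+\tau(\iota(s)-1)$ and $$\bar\mu_{k,s}=\sum_{s'=1+\tau(\iota(s)-1)}^{\tau(\iota(s))}2^{\tau(\iota(s)-1)-s'}M_{k,s'}+2^{\tau(\iota(s)-1)-\tau(\iota(s))}.$$ Given functions $g_t:[0,1]\times\{1,2,\dots\}\to\mathbb R$, $t\ge1$, the leader broadcasts $A_t=t$ for $t\le K$ and, for $t>K$, some $A_t\in\arg\max_{k}\,g_t(\bar\mu_{k,T_k(t-1)},\eta(T_k(t-1)))$ (ties are broken by an arbitrary fixed rule, a function of $t$ and the bits received). **Assumptions on $g$.** Let $f(t)=1+t(\log t)^2$, and let $d(p,q)=p\log\frac pq+(1-p)\log\frac{1-p}{1-q}$ be the Bernoulli Kullback–Leibler divergence. 1. $g_t(x,s)$ is nondecreasing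 in $t$, nondecreasing in $x$ and nonincreasing in $s$. 2. $\lim_{s\to\infty}g_t(x,s)=x$ for all $x\in(0,1)$, $t\ge1$. 3. For all $x\in(0,1)$, $t\ge2$, $s\ge1$: $g_t(x,s)>x$, and if $g_t(x,s)<1$ then $d(x,g_t(x,s))\ge\log(f(t))/s$. For $0<x_1<x_2<1$ let $S_t(x_1,x_2)=\min\{s\ge1:g_t(x_1,s)\le x_2\}$, which is finite by assumption 2. **Lemma.** Under assumptions 1–3, for every $n\ge1$, $$R_n(\pi^a(g),\pi^m)\le\sum_{k=2}^K\Delta_k\inf_{\delta\in(0,\Delta_k/2)}\Big(S_n(\mu_k+\delta,\mu_1-\delta)+3\log_2\Big(S_n(\mu_k+\delta,\mu_1-\delta)\vee\frac4{\delta^2}\Big)+\frac{10}{\delta^2}\Big).$$ Moreover, for every $k\in\{2,\dots,K\}$ and every $\delta\in(0,\Delta_k/2)$, $$\mathbb E[T_k(n)]\le S_n(\mu_k+\delta,\mu_1-\delta)\vee\frac4{\delta^2}+3\log_2\Big(S_n(\mu_k+\delta,\mu_1-\delta)\vee\frac4{\delta^2}\Big)+\frac6{\delta^2}.$$ -/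

import Mathlib

open MeasureTheory ProbabilityTheory

noncomputable section

namespace LeaderFollower

/-! ## The leader-follower game

Arms are indexed by `Fin K`; arm `0` is the first arm.  A message history assigns to every arm
the list of one-bit messages received from it so far (in the order of reception), so that the
length of the list of arm `k` is the number of broadcasts of `k` so far. -/

/-- An arm policy: at time `t`, the arm to broadcast as a function of the messages received
before time `t`. -/
abbrev ArmPolicy (K : ℕ) : Type := ℕ → (Fin K → List Bool) → Fin K

/-- A message policy: at time `t`, the bit to send as a function of the rewards that the
pulled follower has observed up to and including time `t`. -/
abbrev MessagePolicy : Type := ℕ → List ℝ → Bool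

/-- The messages received up to and including time `t`, when the `(i + 1)`-st pull of arm `k`
yields the reward `x k i`. -/
def history {K : ℕ} (pa : ArmPolicy K) (pm : MessagePolicy) (x : Fin K → ℕ → ℝ) :
    ℕ → Fin K → List Bool
  | 0 => fun _ => []
  | t + 1 =>
    let h := history pa pm x t
    let k := pa (t + 1) h
    Function.update h k
      (h k ++ [pm (t + 1) (List.ofFn fun i : Fin ((h k).length + 1) => x k i)])

/-- The arm `A_t` broadcast at time `t = 1, 2, …`. -/
def broadcast {K : ℕ} (pa : ArmPolicy K) (pm : MessagePolicy) (x : Fin K → ℕ → ℝ) (t : ℕ) :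
    Fin K :=
  pa t (history pa pm x (t - 1))

/-- The number `T_k(n)` of broadcasts of arm `k` among the times `1, …, n`. -/
def pullCount {K : ℕ} (pa : ArmPolicy K) (pm : MessagePolicy) (x : Fin K → ℕ → ℝ)
    (k : Fin K) (n : ℕ) : ℕ :=
  ((Finset.Icc 1 n).filter fun t => broadcast pa pm x t = k).card

/-- The number of messages received from an arm is its number of broadcasts. -/
theorem length_history {K : ℕ} (pa : ArmPolicy K) (pm : MessagePolicy) (x : Fin K → ℕ → ℝ)
    (k : Fin K) (n : ℕ) : (history pa pm x n k).length = pullCount pa pm x k n := by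
  induction n with
  | zero => simp [history, pullCount]
  | succ n ih =>
    have hI : Finset.Icc 1 (n + 1) = insert (n + 1) (Finset.Icc 1 n) := by
      ext a; simp only [Finset.mem_Icc, Finset.mem_insert]; omega
    have hb : broadcast pa pm x (n + 1) = pa (n + 1) (history pa pm x n) := by
      simp [broadcast]
    unfold pullCount at ih ⊢
    rw [hI, Finset.filter_insert]
    by_cases h : broadcast pa pm x (n + 1) = k
    · rw [if_pos h, Finset.card_insert_of_notMem (by simp), ← ih]
      rw [hb] at h
      simp [history, h]
    · rw [if_neg h, ← ih]
      rw [hb] at h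
      simp [history, Function.update_of_ne (Ne.symm h)]

/-- The mean reward `μ_k` of arm `k` with reward distribution `ν k`. -/
def armMean {K : ℕ} (ν : Fin K → Measure ℝ) (k : Fin K) : ℝ := ∫ y, y ∂(ν k)

/-- The gap `Δ_k = μ_1 - μ_k`. -/
def gap {K : ℕ} [NeZero K] (ν : Fin K → Measure ℝ) (k : Fin K) : ℝ :=
  armMean ν 0 - armMean ν k

/-- The regret `∑_{t ≤ n} 𝔼[μ_1 - μ_{A_t}]`; `X k i` is the reward of the `(i + 1)`-st pull of
arm `k`. -/
def regret {K : ℕ} [NeZero K] {Ω : Type*} [MeasurableSpace Ω] (P : Measure Ω)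
    (ν : Fin K → Measure ℝ) (X : Fin K → ℕ → Ω → ℝ) (pa : ArmPolicy K) (pm : MessagePolicy)
    (n : ℕ) : ℝ :=
  ∑ t ∈ Finset.Icc 1 n,
    ∫ ω, (armMean ν 0 - armMean ν (broadcast pa pm (fun k i => X k i ω) t)) ∂P

/-! ## Packet schedule -/

/-- `τ(i) = 1 + (i + 1) ⌈log₂ (i + 1)⌉ - 2 ^ ⌈log₂ (i + 1)⌉`, the number of pulls at which the
`i`-th packet is complete. -/
def packetEnd (i : ℕ) : ℕ := 1 + (i + 1) * Nat.clog 2 (i + 1) - 2 ^ Nat.clog 2 (i + 1)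

theorem le_packetEnd_aux (i : ℕ) :
    i + 2 ^ Nat.clog 2 (i + 1) ≤ 1 + (i + 1) * Nat.clog 2 (i + 1) := by
  rcases Nat.eq_zero_or_pos i with rfl | hi
  · simp
  · have h0 : 0 < Nat.clog 2 (i + 1) := Nat.clog_pos (by norm_num) (by omega)
    obtain ⟨c, hc⟩ : ∃ c, Nat.clog 2 (i + 1) = c + 1 := ⟨_, (Nat.succ_pred_eq_of_pos h0).symm⟩
    have h1 : 2 ^ c < i + 1 := by
      have := Nat.pow_pred_clog_lt_self (b := 2) (by norm_num) (x := i + 1) (by omega)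
      simpa [hc] using this
    rw [hc, pow_succ]
    rcases Nat.eq_zero_or_pos c with rfl | hc0
    · simp
      omega
    · rcases Nat.eq_or_lt_of_le (Nat.succ_le_of_lt hc0) with rfl | h2
      · norm_num at h1 ⊢
        omega
      · have : (i + 1) * 3 ≤ (i + 1) * (c + 1) := Nat.mul_le_mul_left _ (by omega)
        omega

/-- The subtraction in `packetEnd` does not truncate. -/
theorem packetEnd_cast (i : ℕ) : (packetEnd i : ℤ) =
    1 + ((i : ℤ) + 1) * ⌈Real.logb 2 ((i : ℝ) + 1)⌉₊ - 2 ^ ⌈Real.logb 2 ((i : ℝ) + 1)⌉₊ := by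
  have h := le_packetEnd_aux i
  have hc : ⌈Real.logb 2 ((i : ℝ) + 1)⌉₊ = Nat.clog 2 (i + 1) := by
    have := Real.natCeil_logb_natCast 2 (i + 1)
    push_cast at this
    exact this
  rw [hc, packetEnd, Nat.cast_sub (by omega)]
  push_cast
  ring

theorem le_packetEnd (i : ℕ) : i ≤ packetEnd i := by
  have := le_packetEnd_aux i
  unfold packetEnd
  omega

/-- `ι(s) = max {i : τ(i) ≤ s}`, the number of complete packets after `s` pulls. -/
def packetCount (s : ℕ) : ℕ := Nat.findGreatest (fun i => packetEnd i ≤ s) s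

theorem packetCount_isGreatest (s : ℕ) : IsGreatest {i | packetEnd i ≤ s} (packetCount s) := by
  constructor
  · exact Nat.findGreatest_spec (P := fun i => packetEnd i ≤ s) (m := 0) (Nat.zero_le s)
      (by simp [packetEnd])
  · intro i hi
    exact Nat.le_findGreatest ((le_packetEnd i).trans hi) hi

/-- `η(s) = 1 + τ(ι(s) - 1)`, the number of samples behind the last complete packet after `s ≥ 1`
pulls. -/
def sampleSize (s : ℕ) : ℕ := 1 + packetEnd (packetCount s - 1)

/-! ## Message policy -/

/-- The quantizer `Γ_α` on `[0, 1]`. -/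
def quantize (α : ℕ) (x : ℝ) : ℤ := if x = 0 then 0 else ⌈(2 : ℝ) ^ α * x⌉ - 1

/-- The mean of the first `m` rewards of a list. -/
def empiricalMean (l : List ℝ) (m : ℕ) : ℝ := (l.take m).sum / m

/-- The integer `Γ_{s - τ(ι(s-1))}(μ̂) - 2 Γ_{s - τ(ι(s-1)) - 1}(μ̂)`, where `s` is the number of
rewards observed and `μ̂` the mean of the first `1 + τ(ι(s-1))` of them. -/
def messageValue (l : List ℝ) : ℤ :=
  let a := packetEnd (packetCount (l.length - 1))
  quantize (l.length - a) (empiricalMean l (1 + a))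
    - 2 * quantize (l.length - a - 1) (empiricalMean l (1 + a))

/-- The message policy `π^m`: transmit the bit `messageValue` (see `messagePolicy_spec`). -/
def messagePolicy : MessagePolicy := fun _ l => decide (messageValue l = 1)

theorem quantize_succ (α : ℕ) {x : ℝ} :
    quantize (α + 1) x - 2 * quantize α x = 0 ∨ quantize (α + 1) x - 2 * quantize α x = 1 := by
  unfold quantize
  split_ifs with h
  · simp
  · have h1 := Int.le_ceil ((2 : ℝ) ^ α * x)
    have h2 := Int.ceil_lt_add_one ((2 : ℝ) ^ α * x)
    have h3 := Int.le_ceil ((2 : ℝ) ^ (α + 1) * x)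
    have h4 := Int.ceil_lt_add_one ((2 : ℝ) ^ (α + 1) * x)
    rw [pow_succ] at *
    have h5 : ((⌈(2 : ℝ) ^ α * 2 * x⌉ : ℤ) : ℝ) < 2 * (⌈(2 : ℝ) ^ α * x⌉ : ℤ) + 1 := by linarith
    have h6 : (2 * (⌈(2 : ℝ) ^ α * x⌉ : ℤ) : ℝ) < (⌈(2 : ℝ) ^ α * 2 * x⌉ : ℤ) + 2 := by linarith
    have h5' : ⌈(2 : ℝ) ^ α * 2 * x⌉ < 2 * ⌈(2 : ℝ) ^ α * x⌉ + 1 := by exact_mod_cast h5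
    have h6' : 2 * ⌈(2 : ℝ) ^ α * x⌉ < ⌈(2 : ℝ) ^ α * 2 * x⌉ + 2 := by exact_mod_cast h6
    omega

/-- `messageValue` is a bit, and `messagePolicy` transmits it. -/
theorem messagePolicy_spec (t : ℕ) {l : List ℝ} (hl : l ≠ []) :
    ((messagePolicy t l).toNat : ℤ) = messageValue l := by
  have hlen : 0 < l.length := List.length_pos_iff.mpr hl
  have ha : packetEnd (packetCount (l.length - 1)) ≤ l.length - 1 :=
    (packetCount_isGreatest (l.length - 1)).1
  obtain ⟨c, hc⟩ : ∃ c, l.length - packetEnd (packetCount (l.length - 1)) = c + 1 :=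
    ⟨l.length - packetEnd (packetCount (l.length - 1)) - 1, by omega⟩
  have key : messageValue l = 0 ∨ messageValue l = 1 := by
    simp only [messageValue, hc, Nat.add_sub_cancel]
    exact quantize_succ c
  rcases key with h | h <;> simp [messagePolicy, h]

/-! ## Arm policy -/

/-- The leader's estimate `μ̄` computed from the list of messages received from an arm:
`∑_{s' = 1 + τ(ι(s)-1)}^{τ(ι(s))} 2^{τ(ι(s)-1) - s'} M_{s'} + 2^{τ(ι(s)-1) - τ(ι(s))}`, with `s`
the number of messages and `M_{s'}` the `s'`-th message. -/
def decode (m : List Bool) : ℝ :=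
  let b := packetEnd (packetCount m.length)
  let a := packetEnd (packetCount m.length - 1)
  (∑ s ∈ Finset.Icc (1 + a) b,
      (2 : ℝ) ^ ((a : ℤ) - (s : ℤ)) * ((m.getD (s - 1) false).toNat : ℝ))
    + (2 : ℝ) ^ ((a : ℤ) - (b : ℤ))

/-- `pa` is the arm policy `π^a(g)`: broadcast arm `t` at the times `t = 1, …, K`, and a maximizer of
`k ↦ g_t(μ̄_k, η(T_k(t-1)))` at the times `t > K`.  Ties may be broken in any way. -/
def IsIndexPolicy {K : ℕ} (g : ℕ → ℝ → ℕ → ℝ) (pa : ArmPolicy K) : Prop :=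
  (∀ t, 1 ≤ t → t ≤ K → ∀ h, (pa t h : ℕ) + 1 = t) ∧
  ∀ t, K < t → ∀ h : Fin K → List Bool, ∀ k : Fin K,
    g t (decode (h k)) (sampleSize (h k).length) ≤
      g t (decode (h (pa t h))) (sampleSize (h (pa t h)).length)

/-! ## Decision functions

A decision function is `g t x s` with `t ≥ 1`, `x ∈ [0, 1]` and `s ≥ 1`; its values at other
arguments play no role. -/

/-- `g_t(x, s)` is increasing in `t`, increasing in `x` and decreasing in `s` (not necessarily
strictly). -/
structure DecisionMonotone (g : ℕ → ℝ → ℕ → ℝ) : Prop where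
  time : ∀ x ∈ Set.Icc (0 : ℝ) 1, ∀ s, 1 ≤ s → MonotoneOn (fun t => g t x s) (Set.Ici 1)
  mean : ∀ t, 1 ≤ t → ∀ s, 1 ≤ s → MonotoneOn (fun x => g t x s) (Set.Icc 0 1)
  pulls : ∀ t, 1 ≤ t → ∀ x ∈ Set.Icc (0 : ℝ) 1, AntitoneOn (fun s => g t x s) (Set.Ici 1)

/-- `g_t(x, s) → x` as `s → ∞`. -/
def DecisionConverges (g : ℕ → ℝ → ℕ → ℝ) : Prop :=
  ∀ x ∈ Set.Ioo (0 : ℝ) 1, ∀ t, 1 ≤ t →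
    Filter.Tendsto (fun s => g t x s) Filter.atTop (nhds x)

/-- `f(t) = 1 + t (log t)²`. -/
def explorationRate (t : ℕ) : ℝ := 1 + t * (Real.log t) ^ 2

/-- The Bernoulli Kullback-Leibler divergence on `[0, 1]²`. -/
def klBernoulli (p q : ℝ) : EReal :=
  if (q = 0 ∧ p ≠ 0) ∨ (q = 1 ∧ p ≠ 1) then ⊤
  else ((p * Real.log (p / q) + (1 - p) * Real.log ((1 - p) / (1 - q)) : ℝ) : EReal)

/-- `g_t(x, s) > x`, and `d(x, g_t(x, s)) ≥ log (f t) / s` when `g_t(x, s) < 1`.  This is asked at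
the times `t ≥ 2` only: at `t = 1`, where `log t = log (f t) = 0`, the UCB1 and KL-UCB decision
functions satisfy `g_1(x, s) = x`. -/
def DecisionExplores (g : ℕ → ℝ → ℕ → ℝ) : Prop :=
  ∀ x ∈ Set.Ioo (0 : ℝ) 1, ∀ t, 2 ≤ t → ∀ s, 1 ≤ s →
    x < g t x s ∧
    (g t x s < 1 → ((Real.log (explorationRate t) / s : ℝ) : EReal) ≤ klBernoulli x (g t x s))

/-- `S_t(x₁, x₂) = min {s ≥ 1 : g_t(x₁, s) ≤ x₂}`; the set is nonempty when `g` satisfies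
`DecisionConverges` and `0 < x₁ < x₂ < 1`, see `fallTime_isLeast`. -/
def fallTime (g : ℕ → ℝ → ℕ → ℝ) (t : ℕ) (x₁ x₂ : ℝ) : ℕ := sInf {s | 1 ≤ s ∧ g t x₁ s ≤ x₂}

theorem fallTime_isLeast {g : ℕ → ℝ → ℕ → ℝ} (hg : DecisionConverges g) {t : ℕ} (ht : 1 ≤ t)
    {x₁ x₂ : ℝ} (h₁ : 0 < x₁) (h₁₂ : x₁ < x₂) (h₂ : x₂ < 1) :
    IsLeast {s | 1 ≤ s ∧ g t x₁ s ≤ x₂} (fallTime g t x₁ x₂) := by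
  have hne : {s | 1 ≤ s ∧ g t x₁ s ≤ x₂}.Nonempty := by
    have h := (hg x₁ ⟨h₁, h₁₂.trans h₂⟩ t ht).eventually (gt_mem_nhds h₁₂)
    obtain ⟨s, hs, hs1⟩ := (h.and (Filter.eventually_ge_atTop 1)).exists
    exact ⟨s, hs1, hs.le⟩
  exact ⟨Nat.sInf_mem hne, fun s hs => Nat.sInf_le hs⟩

end LeaderFollower

end

open LeaderFollower

/-! Fix a suboptimal arm `k` and `δ`, and let `y = max(S_n, 4/δ²)`. After the initial round, arm `k`
is broadcast only if its index is at least that of arm `0`. So either the index of arm `0` is at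
most `μ₁ - δ`, or that of arm `k` exceeds `μ₁ - δ` (`IsIndexPolicy.pullCount_le`).

The first event is rare. The leader's estimate rounds up (`estimate_bounds`), so a low index of arm
`0` at time `t` with `m` samples forces a low sample mean. The exploration assumption gives
divergence at least `log f(t) / m` from `μ₁ - δ`; moving the target to `μ₁` adds `2δ²`
(`klReal_add_sq_le`). Chernoff then bounds the probability by `exp(-2mδ²) / f(t)`
(`exists_event_underestimate`), and summing over `m` and `t` gives `1/δ²`.

For the second event, packets have logarithmic length, so at most `y + 2 log₂ y + 2` pulls rely on
fewer than `y` samples (`card_sampleSize_lt_le`). Beyond these, rounding costs at most `δ/2` and a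
high index forces the sample mean above `μ_k + δ/2` (`le_sampleMean_of_lt_index`). Hoeffding applies
to each sample size. An estimate stays in use for the length of the next packet, at most twice the
number of samples it newly added, so the sum is at most `4/δ²` (`sum_exp_neg_sampleSize_le`). -/

namespace LeaderFollower

/-! ### Packet schedule -/

theorem packetEnd_add_pow (i : ℕ) :
    packetEnd i + 2 ^ Nat.clog 2 (i + 1) = 1 + (i + 1) * Nat.clog 2 (i + 1) := by
  have := le_packetEnd_aux i
  unfold packetEnd
  omega

/-- The closed form is a partial sum of the packet lengths `⌈log₂ (i + 1)⌉`. Passing from `i + 1` to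
`i + 2` raises the logarithm exactly when `i + 1` is a power of two, and in that case the change of
`2 ^ clog` compensates. -/
theorem packetEnd_succ (i : ℕ) : packetEnd (i + 1) = packetEnd i + Nat.clog 2 (i + 2) := by
  have h1 := packetEnd_add_pow i
  have h2 := packetEnd_add_pow (i + 1)
  have hle : i + 1 ≤ 2 ^ Nat.clog 2 (i + 1) := Nat.le_pow_clog (by norm_num) _
  have hmono : Nat.clog 2 (i + 1) ≤ Nat.clog 2 (i + 2) := Nat.clog_mono_right 2 (by omega)
  rw [show i + 1 + 1 = i + 2 from rfl] at h2
  rcases Nat.lt_or_ge (2 ^ Nat.clog 2 (i + 1)) (i + 2) with h | h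
  · have he : 2 ^ Nat.clog 2 (i + 1) = i + 1 := by omega
    have hs : Nat.clog 2 (i + 2) = Nat.clog 2 (i + 1) + 1 := by
      apply le_antisymm
      · rw [Nat.clog_le_iff_le_pow (by norm_num), pow_succ]
        omega
      · by_contra hlt
        have : Nat.clog 2 (i + 2) ≤ Nat.clog 2 (i + 1) := by omega
        rw [Nat.clog_le_iff_le_pow (by norm_num)] at this
        omega
    rw [hs] at h2 ⊢
    rw [pow_succ] at h2
    nlinarith
  · have hs : Nat.clog 2 (i + 2) = Nat.clog 2 (i + 1) := by
      apply le_antisymm _ hmono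
      rwa [Nat.clog_le_iff_le_pow (by norm_num)]
    rw [hs] at h2 ⊢
    nlinarith

theorem packetEnd_zero : packetEnd 0 = 0 := by simp [packetEnd]

theorem packetEnd_strictMono : StrictMono packetEnd := by
  refine strictMono_nat_of_lt_succ fun i => ?_
  rw [packetEnd_succ]
  have : 0 < Nat.clog 2 (i + 2) := Nat.clog_pos (by norm_num) (by omega)
  omega

theorem packetEnd_packetCount_le (s : ℕ) : packetEnd (packetCount s) ≤ s :=
  (packetCount_isGreatest s).1

theorem lt_packetEnd_packetCount_succ (s : ℕ) : s < packetEnd (packetCount s + 1) := by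
  by_contra h
  have hle : packetCount s + 1 ≤ packetCount s := (packetCount_isGreatest s).2 (not_lt.mp h)
  omega

theorem packetCount_eq_iff {s i : ℕ} :
    packetCount s = i ↔ packetEnd i ≤ s ∧ s < packetEnd (i + 1) := by
  constructor
  · rintro rfl
    exact ⟨packetEnd_packetCount_le s, lt_packetEnd_packetCount_succ s⟩
  · rintro ⟨h1, h2⟩
    have h3 := packetEnd_strictMono.lt_iff_lt.mp (h1.trans_lt (lt_packetEnd_packetCount_succ s))
    have h4 := packetEnd_strictMono.lt_iff_lt.mp ((packetEnd_packetCount_le s).trans_lt h2)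
    omega

theorem one_le_packetCount {s : ℕ} (hs : 1 ≤ s) : 1 ≤ packetCount s := by
  apply (packetCount_isGreatest s).2
  have h1 : packetEnd 1 = 1 := by
    rw [packetEnd_succ 0, packetEnd_zero, Nat.clog_of_two_le (by norm_num) (by norm_num)]
    simp
  exact h1.trans_le hs

theorem one_le_sampleSize (s : ℕ) : 1 ≤ sampleSize s := by
  unfold sampleSize
  omega

theorem sampleSize_le {s : ℕ} (hs : 1 ≤ s) : sampleSize s ≤ s := by
  have h1 := one_le_packetCount hs
  have h2 := packetEnd_packetCount_le s
  have h3 : packetEnd (packetCount s - 1) < packetEnd (packetCount s) :=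
    packetEnd_strictMono (by omega)
  unfold sampleSize
  omega

theorem packetEnd_le_sq (i : ℕ) : 1 + packetEnd i ≤ (i + 2) ^ 2 := by
  have h1 := packetEnd_add_pow i
  have h2 : Nat.clog 2 (i + 1) ≤ i := by
    rw [Nat.clog_le_iff_le_pow (by norm_num)]
    exact Nat.lt_two_pow_self
  nlinarith [Nat.zero_le (2 ^ Nat.clog 2 (i + 1)), Nat.mul_le_mul_left (i + 1) h2]

/-- Rounding costs up to `1 / (ι(s) + 1)`; this crude bound makes that at most `δ/2` as soon as
`η(s) ≥ 4/δ²`. -/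
theorem sampleSize_le_sq {s : ℕ} (hs : 1 ≤ s) : sampleSize s ≤ (packetCount s + 1) ^ 2 := by
  obtain ⟨i, hi⟩ := Nat.exists_eq_add_of_le' (one_le_packetCount hs)
  rw [sampleSize, hi]
  exact packetEnd_le_sq i

/-- Since `i + 2 ≤ 2i`, at most one bit is added, and `clog 2 i` is at least one bit. The factor `2`
compares the lifetime of an estimate with the number of samples it newly uses. -/
theorem clog_add_two_le {i : ℕ} (hi : 2 ≤ i) : Nat.clog 2 (i + 2) ≤ 2 * Nat.clog 2 i := by
  have h1 : 1 ≤ Nat.clog 2 i := Nat.clog_pos (by norm_num) hi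
  have h2 : Nat.clog 2 (i + 2) ≤ Nat.clog 2 i + 1 := by
    rw [Nat.clog_le_iff_le_pow (by norm_num), pow_succ]
    have : i ≤ 2 ^ Nat.clog 2 i := Nat.le_pow_clog (by norm_num) _
    omega
  omega

/-! ### Counting early pulls and summing over late ones. -/

theorem clog_lt_logb_add_one_or {m : ℕ} {y : ℝ} (h : (m : ℝ) ≤ y) :
    (Nat.clog 2 m : ℝ) < Real.logb 2 y + 1 ∨ Nat.clog 2 m = 0 := by
  rcases Nat.lt_or_ge m 2 with hm | hm
  · right
    exact Nat.clog_of_right_le_one (by omega) 2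
  · left
    have h1 := Real.natCeil_logb_natCast 2 m
    have h0 : 0 ≤ Real.logb 2 (m : ℝ) :=
      Real.logb_nonneg (by norm_num) (by exact_mod_cast (by omega : 1 ≤ m))
    have h2 := Nat.ceil_lt_add_one h0
    push_cast at h1
    rw [h1] at h2
    have h3 : Real.logb 2 (m : ℝ) ≤ Real.logb 2 y :=
      Real.logb_le_logb_of_le (by norm_num) (by positivity) h
    linarith

/-- Only the first `y + 2 log₂ y + 2` pulls have an estimate based on fewer than `y` samples. -/
theorem card_sampleSize_lt_le (n : ℕ) {y : ℝ} (hy : 2 ≤ y) :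
    ((((Finset.Icc 1 n).filter fun s => (sampleSize s : ℝ) < y).card : ℕ) : ℝ) ≤
      y + 2 * Real.logb 2 y + 2 := by
  set F := (Finset.Icc 1 n).filter fun s => (sampleSize s : ℝ) < y with hF
  have hlog : 1 ≤ Real.logb 2 y := by
    rw [Real.le_logb_iff_rpow_le (by norm_num) (by linarith)]
    simpa using hy
  rcases F.eq_empty_or_nonempty with he | hne
  · rw [he]
    simp only [Finset.card_empty, Nat.cast_zero]
    linarith
  -- The last early pull `s` bounds the count. It precedes the end of packet `i + 2`, two packet
  -- lengths after `packetEnd i < y - 1`; each length is at most `log₂ y + 2` because `i + 3 ≤ 2y`.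
  · set s := F.max' hne with hs
    have hsF : s ∈ F := F.max'_mem hne
    obtain ⟨hs1, hs2⟩ := Finset.mem_filter.mp hsF
    have hs1' : 1 ≤ s := (Finset.mem_Icc.mp hs1).1
    have hsub : F ⊆ Finset.Icc 1 s := fun t ht =>
      Finset.mem_Icc.mpr ⟨(Finset.mem_Icc.mp (Finset.mem_filter.mp ht).1).1, F.le_max' t ht⟩
    have hcard : F.card ≤ s := by simpa using Finset.card_le_card hsub
    obtain ⟨i, hi⟩ := Nat.exists_eq_add_of_le' (one_le_packetCount hs1')
    have hlt := lt_packetEnd_packetCount_succ s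
    rw [hi, packetEnd_succ, packetEnd_succ] at hlt
    rw [sampleSize, hi, Nat.add_sub_cancel] at hs2
    push_cast at hs2
    have hle : ((i : ℕ) : ℝ) ≤ packetEnd i := by exact_mod_cast le_packetEnd i
    have hlog2 : Real.logb 2 (2 * y) = 1 + Real.logb 2 y := by
      rw [Real.logb_mul (by norm_num) (by linarith), Real.logb_self_eq_one (by norm_num)]
    have hc1 : (Nat.clog 2 (i + 2) : ℝ) ≤ Real.logb 2 y + 2 := by
      rcases clog_lt_logb_add_one_or (m := i + 2) (y := 2 * y) (by push_cast; linarith)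
        with h | h
      · rw [hlog2] at h
        linarith
      · rw [h]
        push_cast
        linarith
    have hc2 : (Nat.clog 2 (i + 1 + 2) : ℝ) ≤ Real.logb 2 y + 2 := by
      rcases clog_lt_logb_add_one_or (m := i + 1 + 2) (y := 2 * y) (by push_cast; linarith)
        with h | h
      · rw [hlog2] at h
        linarith
      · rw [h]
        push_cast
        linarith
    have h1 : (F.card : ℝ) + 1 ≤
        packetEnd i + Nat.clog 2 (i + 2) + Nat.clog 2 (i + 1 + 2) := by
      exact_mod_cast (by omega : F.card + 1 ≤ _)
    linarith

/-- Telescoping: `1 + c ≤ exp c` gives `c exp(-mc) ≤ exp(-(m-1)c) - exp(-mc)`. -/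
theorem sum_exp_neg_mul_le (n : ℕ) {c : ℝ} (hc : 0 < c) :
    ∑ m ∈ Finset.Icc 1 n, Real.exp (-(m * c)) ≤ 1 / c := by
  have hind : ∀ n : ℕ, ∑ m ∈ Finset.Icc 1 n, Real.exp (-(m * c)) ≤
      1 / c * (1 - Real.exp (-(n * c))) := by
    intro n
    induction n with
    | zero => simp
    | succ n ih =>
      rw [Finset.sum_Icc_succ_top (by omega)]
      have h1 : Real.exp (-(n * c)) = Real.exp (-((n + 1 : ℕ) * c)) * Real.exp c := by
        rw [← Real.exp_add]
        congr 1
        push_cast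
        ring
      have h2 := Real.add_one_le_exp c
      have h3 := Real.exp_pos (-((n + 1 : ℕ) * c))
      have h4 : Real.exp (-((n + 1 : ℕ) * c)) * c ≤
          Real.exp (-(n * c)) - Real.exp (-((n + 1 : ℕ) * c)) := by
        rw [h1]
        nlinarith
      have h5 : Real.exp (-((n + 1 : ℕ) * c)) ≤
          1 / c * (Real.exp (-(n * c)) - Real.exp (-((n + 1 : ℕ) * c))) := by
        rw [one_div, inv_mul_eq_div, le_div_iff₀ hc]
        exact h4
      linarith
  refine (hind n).trans ?_
  have h3 := Real.exp_pos (-(n * c))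
  have : 0 < 1 / c := by positivity
  nlinarith

/-- Late pulls: `∑_s exp (-c η(s))` over the pulls with at least two complete packets. -/
theorem sum_exp_neg_sampleSize_le (n : ℕ) {c : ℝ} (hc : 0 < c) :
    ∑ s ∈ (Finset.Icc 1 n).filter (fun s => 2 ≤ packetCount s),
      Real.exp (-(sampleSize s * c)) ≤ 2 / c := by
  have hmaps : ∀ s ∈ (Finset.Icc 1 n).filter (fun s => 2 ≤ packetCount s),
      packetCount s ∈ Finset.Icc 2 n := by
    intro s hs
    simp only [Finset.mem_filter, Finset.mem_Icc] at hs ⊢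
    exact ⟨hs.2, ((le_packetEnd _).trans (packetEnd_packetCount_le s)).trans hs.1.2⟩
  rw [← Finset.sum_fiberwise_of_maps_to hmaps]
  -- All pulls with `ι(s) = i` share one sample size, and there are at most `clog 2 (i + 2)` of
  -- them. They are charged to the `clog 2 i` integers between the previous sample size and this
  -- one, where the exponential is no smaller. For `i = 1` there is no such block.
  have hfib : ∀ i ∈ Finset.Icc 2 n,
      ∑ s ∈ ((Finset.Icc 1 n).filter (fun s => 2 ≤ packetCount s)).filter
        (fun s => packetCount s = i), Real.exp (-(sampleSize s * c)) ≤
      2 * ∑ m ∈ Finset.Ioc (1 + packetEnd (i - 2)) (1 + packetEnd (i - 1)),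
        Real.exp (-(m * c)) := by
    intro i hi
    obtain ⟨j, rfl⟩ := Nat.exists_eq_add_of_le' (Finset.mem_Icc.mp hi).1
    have hsize : ∀ s, packetCount s = j + 2 → sampleSize s = 1 + packetEnd (j + 1) := by
      intro s hs
      rw [sampleSize, hs]
      rfl
    rw [Finset.sum_congr rfl (g := fun _ => Real.exp (-((1 + packetEnd (j + 1) : ℕ) * c)))
      (fun s hs => by rw [hsize s (Finset.mem_filter.mp hs).2])]
    rw [Finset.sum_const, nsmul_eq_mul]
    have hcard : (((Finset.Icc 1 n).filter (fun s => 2 ≤ packetCount s)).filter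
        (fun s => packetCount s = j + 2)).card ≤ Nat.clog 2 (j + 2 + 2) := by
      have hsub : (((Finset.Icc 1 n).filter (fun s => 2 ≤ packetCount s)).filter
        (fun s => packetCount s = j + 2)) ⊆ Finset.Ico (packetEnd (j + 2))
          (packetEnd (j + 2 + 1)) := by
        intro s hs
        exact Finset.mem_Ico.mpr (packetCount_eq_iff.mp (Finset.mem_filter.mp hs).2)
      have := Finset.card_le_card hsub
      rw [Nat.card_Ico, packetEnd_succ] at this
      omega
    have hlow : (Nat.clog 2 (j + 2) : ℝ) * Real.exp (-((1 + packetEnd (j + 1) : ℕ) * c)) ≤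
        ∑ m ∈ Finset.Ioc (1 + packetEnd (j + 2 - 2)) (1 + packetEnd (j + 2 - 1)),
          Real.exp (-(m * c)) := by
      have hc2 : (Finset.Ioc (1 + packetEnd (j + 2 - 2)) (1 + packetEnd (j + 2 - 1))).card =
          Nat.clog 2 (j + 2) := by
        rw [Nat.card_Ioc, show j + 2 - 2 = j by omega, show j + 2 - 1 = j + 1 by omega,
          packetEnd_succ]
        omega
      rw [← hc2, ← nsmul_eq_mul]
      apply Finset.card_nsmul_le_sum
      intro m hm
      apply Real.exp_le_exp.mpr
      have : (m : ℝ) ≤ (1 + packetEnd (j + 1) : ℕ) := by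
        exact_mod_cast (Finset.mem_Ioc.mp hm).2
      nlinarith
    have hcl : ((((Finset.Icc 1 n).filter (fun s => 2 ≤ packetCount s)).filter
        (fun s => packetCount s = j + 2)).card : ℝ) ≤ 2 * Nat.clog 2 (j + 2) := by
      exact_mod_cast hcard.trans (clog_add_two_le (by omega))
    have hpos := Real.exp_pos (-((1 + packetEnd (j + 1) : ℕ) * c))
    nlinarith
  refine (Finset.sum_le_sum hfib).trans ?_
  rw [← Finset.mul_sum]
  -- The charged blocks are consecutive, so their total is a sum over distinct integers.
  have htel : ∀ n : ℕ, ∑ i ∈ Finset.Icc 2 n,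
      ∑ m ∈ Finset.Ioc (1 + packetEnd (i - 2)) (1 + packetEnd (i - 1)), Real.exp (-(m * c)) ≤
      ∑ m ∈ Finset.Icc 1 (1 + packetEnd (n - 1)), Real.exp (-(m * c)) := by
    intro n
    induction n with
    | zero => 
      simp only [show Finset.Icc 2 0 = ∅ from rfl, Finset.sum_empty]
      positivity
    | succ n ih =>
      rcases Nat.lt_or_ge n 1 with h | h
      · rw [Finset.Icc_eq_empty (by omega), Finset.sum_empty]
        positivity
      · rw [Finset.sum_Icc_succ_top (by omega)]
        have hle : packetEnd (n - 1) ≤ packetEnd (n + 1 - 1) :=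
          packetEnd_strictMono.monotone (by omega)
        have hunion : Finset.Icc 1 (1 + packetEnd (n + 1 - 1)) =
            Finset.Icc 1 (1 + packetEnd (n - 1)) ∪
              Finset.Ioc (1 + packetEnd (n - 1)) (1 + packetEnd (n + 1 - 1)) := by
          ext a
          simp only [Finset.mem_union, Finset.mem_Icc, Finset.mem_Ioc]
          omega
        rw [hunion, Finset.sum_union, show n + 1 - 2 = n - 1 by omega]
        · linarith
        · rw [Finset.disjoint_left]
          intro a
          simp only [Finset.mem_Icc, Finset.mem_Ioc]
          omega
  have h1 := htel n
  have h2 := sum_exp_neg_mul_le (1 + packetEnd (n - 1)) hc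
  have h3 : 2 / c = 2 * (1 / c) := by ring
  rw [h3]
  linarith

/-! ### Messages and estimates of a single arm -/

/-- The mean of the first `m` terms of a reward sequence. -/
noncomputable def sampleMean (x : ℕ → ℝ) (m : ℕ) : ℝ := (∑ i ∈ Finset.range m, x i) / m

/-- The `(s + 1)`-st message of an arm with reward sequence `x`. -/
noncomputable def message (x : ℕ → ℝ) (s : ℕ) : Bool :=
  -- The time `0` is immaterial: `messagePolicy` ignores its first argument.
  messagePolicy 0 (List.ofFn fun i : Fin (s + 1) => x i)

/-- The leader's estimate after `s` messages from an arm with reward sequence `x`. -/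
noncomputable def estimate (x : ℕ → ℝ) (s : ℕ) : ℝ := decode ((List.range s).map (message x))

theorem empiricalMean_ofFn (x : ℕ → ℝ) {n m : ℕ} (h : m ≤ n) :
    empiricalMean (List.ofFn fun i : Fin n => x i) m = sampleMean x m := by
  have h1 : (List.ofFn fun i : Fin n => x i).take m = (List.range m).map x := by
    apply List.ext_getElem
    · simp [h]
    · intro i h1 h2
      simp
  rw [empiricalMean, h1, sampleMean, Finset.sum_range, ← List.sum_ofFn]
  congr 2
  apply List.ext_getElem
  · simp
  · intro i h1 h2
    simp

theorem messageValue_ofFn (x : ℕ → ℝ) (s : ℕ) :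
    messageValue (List.ofFn fun i : Fin (s + 1) => x i) =
      quantize (s + 1 - packetEnd (packetCount s)) (sampleMean x (1 + packetEnd (packetCount s)))
      - 2 * quantize (s - packetEnd (packetCount s))
        (sampleMean x (1 + packetEnd (packetCount s))) := by
  have h := packetEnd_packetCount_le s
  simp only [messageValue, List.length_ofFn, Nat.add_sub_cancel]
  rw [empiricalMean_ofFn x (by omega),
    show s + 1 - packetEnd (packetCount s) - 1 = s - packetEnd (packetCount s) by omega]

theorem message_toNat (x : ℕ → ℝ) (s : ℕ) :
    ((message x s).toNat : ℤ) =
      quantize (s + 1 - packetEnd (packetCount s)) (sampleMean x (1 + packetEnd (packetCount s)))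
      - 2 * quantize (s - packetEnd (packetCount s))
        (sampleMean x (1 + packetEnd (packetCount s))) := by
  rw [message, messagePolicy_spec 0 (by simp), messageValue_ofFn]

theorem quantize_zero_left {x : ℝ} (hx : x ∈ Set.Icc (0 : ℝ) 1) : quantize 0 x = 0 := by
  unfold quantize
  split_ifs with h
  · rfl
  · have h1 : ⌈x⌉ = 1 := by
      rw [Int.ceil_eq_iff]
      have := lt_of_le_of_ne hx.1 (Ne.symm h)
      norm_num
      exact ⟨this, hx.2⟩
    simp [h1]

theorem quantize_bounds (α : ℕ) {x : ℝ} (hx : x ∈ Set.Icc (0 : ℝ) 1) :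
    0 ≤ quantize α x ∧ (2 : ℝ) ^ α * x ≤ quantize α x + 1 ∧
      (quantize α x : ℝ) ≤ 2 ^ α * x ∧ (quantize α x : ℝ) + 1 ≤ 2 ^ α := by
  unfold quantize
  split_ifs with h
  · have : (1 : ℝ) ≤ 2 ^ α := one_le_pow₀ (by norm_num)
    simp [h, this]
  · have hx0 := lt_of_le_of_ne hx.1 (Ne.symm h)
    have h1 : 0 < ⌈(2 : ℝ) ^ α * x⌉ := Int.ceil_pos.mpr (by positivity)
    have h2 := Int.le_ceil ((2 : ℝ) ^ α * x)
    have h3 := Int.ceil_lt_add_one ((2 : ℝ) ^ α * x)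
    have h4 : ⌈(2 : ℝ) ^ α * x⌉ ≤ ((2 ^ α : ℕ) : ℤ) := by
      apply Int.ceil_le.mpr
      push_cast
      have : (0 : ℝ) < 2 ^ α := by positivity
      nlinarith [hx.2]
    have h4' : (⌈(2 : ℝ) ^ α * x⌉ : ℝ) ≤ ((2 ^ α : ℕ) : ℝ) := by exact_mod_cast h4
    push_cast at h4' ⊢
    exact ⟨by omega, by linarith, by linarith, by linarith⟩

theorem sampleMean_mem_Icc {x : ℕ → ℝ} (hx : ∀ i, x i ∈ Set.Icc (0 : ℝ) 1) (m : ℕ) :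
    sampleMean x m ∈ Set.Icc (0 : ℝ) 1 := by
  constructor
  · exact div_nonneg (Finset.sum_nonneg fun i _ => (hx i).1) (Nat.cast_nonneg m)
  · apply div_le_one_of_le₀ _ (Nat.cast_nonneg m)
    calc ∑ i ∈ Finset.range m, x i ≤ ∑ i ∈ Finset.range m, 1 :=
          Finset.sum_le_sum fun i _ => (hx i).2
      _ = m := by simp

/-- The bits of a packet are the binary digits of the quantized sample mean. -/
theorem sum_packet {x : ℕ → ℝ} (hx : ∀ i, x i ∈ Set.Icc (0 : ℝ) 1) (i L : ℕ)
    (hL : packetEnd i + L ≤ packetEnd (i + 1)) :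
    ∑ s ∈ Finset.Icc (1 + packetEnd i) (packetEnd i + L),
      (2 : ℝ) ^ ((packetEnd i : ℤ) - (s : ℤ)) * ((message x (s - 1)).toNat : ℝ) =
    quantize L (sampleMean x (1 + packetEnd i)) / 2 ^ L := by
  -- The partial sums telescope: the next bit, of weight `2^-(L+1)`, refines `Γ_L / 2^L` to `Γ_{L+1}
  -- / 2^{L+1}`. Throughout the packet `packetCount` stays at `i`, so all bits describe the same
  -- sample mean.
  induction L with
  | zero =>
    rw [Finset.Icc_eq_empty (by omega), quantize_zero_left (sampleMean_mem_Icc hx _)]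
    simp
  | succ L ih =>
    rw [← add_assoc, Finset.sum_Icc_succ_top (by omega), ih (by omega), Nat.add_sub_cancel]
    have hc : packetCount (packetEnd i + L) = i := packetCount_eq_iff.mpr ⟨by omega, by omega⟩
    have hm : ((message x (packetEnd i + L)).toNat : ℝ) =
        quantize (L + 1) (sampleMean x (1 + packetEnd i))
          - 2 * quantize L (sampleMean x (1 + packetEnd i)) := by
      have := message_toNat x (packetEnd i + L)
      rw [hc, show packetEnd i + L + 1 - packetEnd i = L + 1 by omega, Nat.add_sub_cancel_left]
        at this
      exact_mod_cast this
    rw [hm]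
    have hexp : (packetEnd i : ℤ) - ((packetEnd i + L + 1 : ℕ) : ℤ) = -((L + 1 : ℕ) : ℤ) := by
      push_cast
      ring
    rw [hexp, zpow_neg, zpow_natCast]
    field_simp
    ring

/-- The last term of `decode` replaces the left end of the dyadic cell of the sample mean by its
right end; this is the `+ 1`. -/
theorem estimate_eq {x : ℕ → ℝ} (hx : ∀ i, x i ∈ Set.Icc (0 : ℝ) 1) {s i : ℕ}
    (hi : packetCount s = i + 1) :
    estimate x s =
      (quantize (Nat.clog 2 (i + 2)) (sampleMean x (1 + packetEnd i)) + 1) /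
        2 ^ Nat.clog 2 (i + 2) := by
  have hs := packetEnd_packetCount_le s
  rw [hi] at hs
  have hsum := sum_packet hx i (Nat.clog 2 (i + 2)) (packetEnd_succ i).ge
  have hexp : (packetEnd i : ℤ) - (packetEnd (i + 1) : ℤ) = -(Nat.clog 2 (i + 2) : ℤ) := by
    rw [packetEnd_succ]
    push_cast
    ring
  simp only [estimate, decode, List.length_map, List.length_range, hi, Nat.add_sub_cancel]
  rw [hexp, zpow_neg, zpow_natCast, add_div, ← hsum, ← packetEnd_succ, one_div]
  congr 1
  apply Finset.sum_congr rfl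
  intro t ht
  have ht' := Finset.mem_Icc.mp ht
  congr 3
  rw [List.getD_eq_getElem _ _ (by simp; omega)]
  simp

/-- Rounding up keeps the estimate positive, inside the domain of the assumptions on `g`, and never
below the sample mean, so quantization cannot cause underestimation. A packet of `clog 2 (i + 2)`
bits resolves at least `i + 2` cells. -/
theorem estimate_bounds {x : ℕ → ℝ} (hx : ∀ i, x i ∈ Set.Icc (0 : ℝ) 1) {s : ℕ} (hs : 1 ≤ s) :
    0 < estimate x s ∧ estimate x s ≤ 1 ∧ sampleMean x (sampleSize s) ≤ estimate x s ∧
      estimate x s ≤ sampleMean x (sampleSize s) + 1 / (packetCount s + 1) := by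
  obtain ⟨i, hi⟩ := Nat.exists_eq_add_of_le' (one_le_packetCount hs)
  have hsize : sampleSize s = 1 + packetEnd i := by
    rw [sampleSize, hi, Nat.add_sub_cancel]
  rw [hsize, estimate_eq hx hi, hi]
  obtain ⟨h1, h2, h3, h4⟩ := quantize_bounds (Nat.clog 2 (i + 2))
    (sampleMean_mem_Icc hx (1 + packetEnd i))
  have hp : (0 : ℝ) < 2 ^ Nat.clog 2 (i + 2) := by positivity
  have hle : ((i : ℝ) + 1 + 1) ≤ 2 ^ Nat.clog 2 (i + 2) := by
    have := Nat.le_pow_clog (b := 2) (by norm_num) (i + 2)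
    have h : ((i + 2 : ℕ) : ℝ) ≤ ((2 ^ Nat.clog 2 (i + 2) : ℕ) : ℝ) := by exact_mod_cast this
    push_cast at h
    linarith
  have h1' : (0 : ℝ) ≤ quantize (Nat.clog 2 (i + 2)) (sampleMean x (1 + packetEnd i)) := by
    exact_mod_cast h1
  refine ⟨by positivity, ?_, ?_, ?_⟩
  · rw [div_le_one hp]
    exact h4
  · rw [le_div_iff₀ hp]
    linarith
  · have h5 : (1 : ℝ) / 2 ^ Nat.clog 2 (i + 2) ≤ 1 / (((i + 1 : ℕ) : ℝ) + 1) := by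
      apply one_div_le_one_div_of_le (by positivity)
      push_cast
      exact hle
    rw [add_div]
    apply add_le_add _ h5
    rw [div_le_iff₀ hp]
    linarith

/-! ### Measurability -/

theorem measurable_quantize (α : ℕ) : Measurable (quantize α) := by
  unfold quantize
  refine Measurable.ite (measurableSet_singleton 0) measurable_const ?_
  exact (Int.measurable_ceil.comp (measurable_const.mul measurable_id)).sub_const 1

theorem measurable_sampleMean {Ω : Type*} [MeasurableSpace Ω] {X : ℕ → Ω → ℝ}
    (hX : ∀ i, Measurable (X i)) (m : ℕ) : Measurable fun ω => sampleMean (fun i => X i ω) m := by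
  unfold sampleMean
  exact (Finset.measurable_sum _ fun i _ => hX i).div_const _

theorem measurable_message {Ω : Type*} [MeasurableSpace Ω] {X : ℕ → Ω → ℝ}
    (hX : ∀ i, Measurable (X i)) (s : ℕ) : Measurable fun ω => message (fun i => X i ω) s := by
  have h := measurable_sampleMean hX (1 + packetEnd (packetCount s))
  have h1 := ((measurable_quantize (s + 1 - packetEnd (packetCount s))).comp h).sub
    (((measurable_quantize (s - packetEnd (packetCount s))).comp h).const_mul 2)
  have h2 : Measurable fun ω => messageValue (List.ofFn fun i : Fin (s + 1) => X i ω) :=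
    (funext fun ω => messageValue_ofFn (fun i => X i ω) s) ▸ h1
  exact (measurable_of_countable fun z : ℤ => decide (z = 1)).comp h2

/-- Messages do not depend on time, so the view of an arm is determined by its own rewards and its
pull count. This allows union bounds over the pull count. -/
theorem history_messagePolicy {K : ℕ} (pa : ArmPolicy K) (x : Fin K → ℕ → ℝ) (t : ℕ) (k : Fin K) :
    history pa messagePolicy x t k =
      (List.range (pullCount pa messagePolicy x k t)).map (message (x k)) := by
  rw [← length_history]
  induction t generalizing k with
  | zero => simp [history]
  | succ t ih =>
    by_cases h : pa (t + 1) (history pa messagePolicy x t) = k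
    · subst h
      simp only [history, Function.update_self, List.length_append, List.length_singleton,
        List.range_succ, List.map_append, List.map_singleton]
      rw [← ih]
      rfl
    · simp only [history]
      rw [Function.update_of_ne (Ne.symm h)]
      exact ih k

theorem measurable_history {K : ℕ} (pa : ArmPolicy K) {Ω : Type*} [MeasurableSpace Ω]
    {X : Fin K → ℕ → Ω → ℝ} (hX : ∀ k i, Measurable (X k i)) (t : ℕ) :
    Measurable[_, ⊤] fun ω => history pa messagePolicy (fun k i => X k i ω) t := by
  let : MeasurableSpace (Fin K → List Bool) := ⊤
  have : MeasurableSingletonClass (Fin K → List Bool) := ⟨fun _ => trivial⟩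
  induction t with
  | zero => exact measurable_const
  | succ t ih =>
    let F : (Fin K → List Bool) → Ω → Fin K → List Bool := fun h ω =>
      Function.update h (pa (t + 1) h)
        (h (pa (t + 1) h) ++ [message (fun i => X (pa (t + 1) h) i ω)
          (h (pa (t + 1) h)).length])
    have hF : ∀ h, Measurable (F h) := fun h =>
      (measurable_of_countable fun b : Bool => Function.update h (pa (t + 1) h)
        (h (pa (t + 1) h) ++ [b])).comp
        (measurable_message (hX (pa (t + 1) h)) (h (pa (t + 1) h)).length)
    -- Histories form a countable set, and for a fixed past the next history depends on one
    -- measurable bit.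
    have hF2 : Measurable (fun p : (Fin K → List Bool) × Ω => F p.1 p.2) :=
      measurable_from_prod_countable_right hF
    exact hF2.comp (ih.prodMk measurable_id)

theorem measurable_broadcast {K : ℕ} (pa : ArmPolicy K) {Ω : Type*} [MeasurableSpace Ω]
    {X : Fin K → ℕ → Ω → ℝ} (hX : ∀ k i, Measurable (X k i)) (t : ℕ) :
    Measurable fun ω => broadcast pa messagePolicy (fun k i => X k i ω) t := by
  let : MeasurableSpace (Fin K → List Bool) := ⊤
  exact (measurable_from_top (f := pa t)).comp (measurable_history pa hX (t - 1))

/-! ### Bernoulli divergence -/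

/-- The Bernoulli Kullback-Leibler divergence on `(0, 1)²`, as a real number. -/
noncomputable def klReal (p q : ℝ) : ℝ :=
  p * Real.log (p / q) + (1 - p) * Real.log ((1 - p) / (1 - q))

theorem klBernoulli_eq_coe {p q : ℝ} (hq : q ∈ Set.Ioo (0 : ℝ) 1) :
    klBernoulli p q = (klReal p q : EReal) := by
  have h0 : q ≠ 0 := hq.1.ne'
  have h1 : q ≠ 1 := hq.2.ne
  simp [klBernoulli, klReal, h0, h1]

/-- The derivative of `klReal y` at `z` is `(z - y) / (z (1 - z)) ≥ 4 (z - y) ≥ 4 (z - a)`, the last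
being the derivative of `2 (z - a)²`. -/
theorem klReal_add_sq_le {y a b : ℝ} (hy : 0 < y) (hya : y ≤ a) (hab : a ≤ b) (hb : b < 1) :
    klReal y a + 2 * (b - a) ^ 2 ≤ klReal y b := by
  have ha : 0 < a := hy.trans_le hya
  let F : ℝ → ℝ := fun z => -(y * Real.log z) - (1 - y) * Real.log (1 - z) - 2 * (z - a) ^ 2
  have hder : ∀ z ∈ Set.Icc a b, HasDerivAt F
      (-(y * (1 / z)) - (1 - y) * (-1 / (1 - z)) - 2 * (2 * (z - a))) z := by
    intro z hz
    have hz0 : z ≠ 0 := (ha.trans_le hz.1).ne'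
    have hz1 : 1 - z ≠ 0 := by linarith [hz.2]
    have h1 := ((hasDerivAt_id z).log hz0).const_mul y
    have h2 := (((hasDerivAt_id z).const_sub 1).log hz1).const_mul (1 - y)
    have h3 := (((hasDerivAt_id z).sub_const a).pow 2).const_mul 2
    exact ((h1.neg.sub h2).sub h3).congr_deriv (by simp)
  have hmono : MonotoneOn F (Set.Icc a b) := by
    apply monotoneOn_of_deriv_nonneg (convex_Icc a b)
    · exact fun z hz => (hder z hz).continuousAt.continuousWithinAt
    · exact fun z hz => (hder z (interior_subset hz)).differentiableAt.differentiableWithinAt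
    · intro z hz
      have hz' := interior_subset hz
      rw [(hder z hz').deriv]
      have hz0 : 0 < z := ha.trans_le hz'.1
      have hz1 : 0 < 1 - z := by linarith [hz'.2]
      have hid : -(y * (1 / z)) - (1 - y) * (-1 / (1 - z)) = (z - y) / (z * (1 - z)) := by
        field_simp
        ring
      rw [hid]
      have h4 : 4 * (z - y) ≤ (z - y) / (z * (1 - z)) := by
        rw [le_div_iff₀ (by positivity)]
        have h5 : 4 * (z * (1 - z)) ≤ 1 := by nlinarith [sq_nonneg (2 * z - 1)]
        have h6 : 0 ≤ z - y := by linarith [hz'.1]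
        nlinarith
      linarith
  have h := hmono (Set.left_mem_Icc.mpr hab) (Set.right_mem_Icc.mpr hab) hab
  have hkl : ∀ z, 0 < z → z < 1 → klReal y z =
      y * Real.log y + (1 - y) * Real.log (1 - y) - y * Real.log z
        - (1 - y) * Real.log (1 - z) := by
    intro z h0 h1
    rw [klReal, Real.log_div hy.ne' h0.ne', Real.log_div (by linarith) (by linarith)]
    ring
  rw [hkl a ha (by linarith), hkl b (by linarith) hb]
  simp only [F, sub_self] at h
  linarith

theorem continuousOn_klReal {q : ℝ} (hq : q ∈ Set.Ioo (0 : ℝ) 1) :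
    ContinuousOn (fun p => klReal p q) (Set.Ioo 0 1) := by
  unfold klReal
  intro p hp
  have h0 : p / q ≠ 0 := (div_pos hp.1 hq.1).ne'
  have h1 : (1 - p) / (1 - q) ≠ 0 := (div_pos (by linarith [hp.2]) (by linarith [hq.2])).ne'
  apply ContinuousAt.continuousWithinAt
  fun_prop (disch := assumption)

/-! ### Concentration of sample means -/

section Concentration

variable {Ω : Type*} [MeasurableSpace Ω] {P : Measure Ω} [IsProbabilityMeasure P]

/-- By convexity `exp(tY)` lies below its chord on `[0, 1]`: among variables with a given mean the
Bernoulli one is extremal. -/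
theorem mgf_le_of_mem_Icc_zero_one {Y : Ω → ℝ} (hm : Measurable Y)
    (h01 : ∀ᵐ ω ∂P, Y ω ∈ Set.Icc (0 : ℝ) 1) (t : ℝ) :
    mgf Y P t ≤ 1 - P[Y] + P[Y] * Real.exp t := by
  have hint : Integrable Y P := Integrable.of_mem_Icc 0 1 hm.aemeasurable h01
  have h : mgf Y P t ≤ ∫ ω, (1 + Y ω * (Real.exp t - 1)) ∂P := by
    apply integral_mono_ae (integrable_exp_mul_of_mem_Icc hm.aemeasurable h01)
      ((integrable_const _).add (hint.mul_const _))
    filter_upwards [h01] with ω hω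
    have := convexOn_exp.2 (Set.mem_univ 0) (Set.mem_univ t)
      (show 0 ≤ 1 - Y ω by linarith [hω.2]) hω.1 (by ring)
    simp only [smul_eq_mul, mul_zero, zero_add, Real.exp_zero, mul_one] at this
    change Real.exp (t * Y ω) ≤ 1 + Y ω * (Real.exp t - 1)
    rw [mul_comm t]
    linarith
  rw [integral_add (integrable_const _) (hint.mul_const _), integral_mul_const] at h
  simp only [integral_const, probReal_univ, smul_eq_mul, mul_one] at h
  linarith

variable {X : ℕ → Ω → ℝ} (hXm : ∀ i, Measurable (X i)) (hind : iIndepFun X P)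
  (h01 : ∀ i, ∀ᵐ ω ∂P, X i ω ∈ Set.Icc (0 : ℝ) 1) {μ : ℝ} (hmean : ∀ i, P[X i] = μ)

include hXm hind h01 hmean

/-- Chernoff's bound for the lower tail, in terms of the Bernoulli divergence. -/
theorem measure_sampleMean_le_le {m : ℕ} (hm : 1 ≤ m) {y : ℝ} (hy : 0 < y) (hyμ : y ≤ μ)
    (hμ : μ < 1) :
    P.real {ω | sampleMean (fun i => X i ω) m ≤ y} ≤ Real.exp (-(m * klReal y μ)) := by
  have hμ0 : 0 < μ := hy.trans_le hyμ
  have hm0 : (0 : ℝ) < m := by exact_mod_cast hm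
  have h1y : 0 < 1 - y := by linarith
  have h1μ : 0 < 1 - μ := by linarith
  have hr : 0 < y * (1 - μ) / (μ * (1 - y)) := by positivity
  -- The optimal Chernoff parameter for a Bernoulli variable; with it `1 - μ + μ exp t = (1 - μ) /
  -- (1 - y)`.
  set t := Real.log (y * (1 - μ) / (μ * (1 - y))) with ht
  have ht0 : t ≤ 0 := by
    apply Real.log_nonpos hr.le
    rw [div_le_one (by positivity)]
    nlinarith
  have hset : {ω | sampleMean (fun i => X i ω) m ≤ y} =
      {ω | (∑ i ∈ Finset.range m, X i) ω ≤ m * y} := by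
    ext ω
    simp only [Set.mem_ofPred_eq, sampleMean, Finset.sum_apply]
    rw [div_le_iff₀ hm0, mul_comm]
  have hb := measure_le_le_exp_mul_mgf (μ := P) (X := ∑ i ∈ Finset.range m, X i) (m * y) ht0
    (hind.integrable_exp_mul_sum hXm
      (fun i _ => integrable_exp_mul_of_mem_Icc (hXm i).aemeasurable (h01 i)))
  rw [hset]
  refine hb.trans ?_
  rw [hind.mgf_sum hXm]
  have hprod : ∏ i ∈ Finset.range m, mgf (X i) P t ≤ ((1 - μ) / (1 - y)) ^ m := by
    calc ∏ i ∈ Finset.range m, mgf (X i) P t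
        ≤ ∏ _i ∈ Finset.range m, ((1 - μ) / (1 - y)) := by
          apply Finset.prod_le_prod (fun i _ => mgf_nonneg)
          intro i _
          refine (mgf_le_of_mem_Icc_zero_one (hXm i) (h01 i) t).trans_eq ?_
          rw [hmean i, ht, Real.exp_log hr]
          field_simp
          ring
      _ = _ := by rw [Finset.prod_const, Finset.card_range]
  calc Real.exp (-t * (m * y)) * ∏ i ∈ Finset.range m, mgf (X i) P t
      ≤ Real.exp (-t * (m * y)) * ((1 - μ) / (1 - y)) ^ m :=
        mul_le_mul_of_nonneg_left hprod (Real.exp_pos _).le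
    _ = Real.exp (-(m * klReal y μ)) := by
        rw [← Real.exp_log (show 0 < (1 - μ) / (1 - y) by positivity), ← Real.exp_nat_mul,
          ← Real.exp_add]
        congr 1
        rw [ht, klReal, Real.log_div (by positivity) (by positivity),
          Real.log_div h1μ.ne' h1y.ne', Real.log_mul hy.ne' h1μ.ne',
          Real.log_mul hμ0.ne' h1y.ne', Real.log_div hy.ne' hμ0.ne',
          Real.log_div h1y.ne' h1μ.ne']
        ring

/-- Hoeffding's inequality for the upper tail. -/
theorem measure_le_sampleMean_le {m : ℕ} (hm : 1 ≤ m) {ε : ℝ} (hε : 0 ≤ ε) :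
    P.real {ω | μ + ε ≤ sampleMean (fun i => X i ω) m} ≤ Real.exp (-(m * (2 * ε ^ 2))) := by
  have hm0 : (0 : ℝ) < m := by exact_mod_cast hm
  have hset : {ω | μ + ε ≤ sampleMean (fun i => X i ω) m} =
      {ω | m * ε ≤ ∑ i ∈ Finset.range m, (X i ω - P[X i])} := by
    ext ω
    simp only [Set.mem_ofPred_eq, sampleMean, hmean, Finset.sum_sub_distrib, Finset.sum_const,
      Finset.card_range, nsmul_eq_mul]
    rw [le_div_iff₀ hm0, le_sub_iff_add_le, mul_comm, mul_add, add_comm]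
  have hind' : iIndepFun (fun i ω => X i ω - P[X i]) P :=
    hind.comp (fun i z => z - ∫ ω, X i ω ∂P) fun i => measurable_id.sub_const _
  have h := HasSubgaussianMGF.measure_sum_range_ge_le_of_iIndepFun hind' (n := m)
    (fun i _ => hasSubgaussianMGF_of_mem_Icc (hXm i).aemeasurable (h01 i))
    (ε := m * ε) (by positivity)
  rw [hset]
  refine h.trans_eq ?_
  congr 1
  push_cast
  norm_num
  field_simp
  ring

/-- The optimal arm looks bad at time `t` with `m` samples only on an event of small probability. -/
theorem exists_event_underestimate {g : ℕ → ℝ → ℕ → ℝ} (hmono : DecisionMonotone g)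
    (hexpl : DecisionExplores g) {t m : ℕ} (ht : 2 ≤ t) (hm : 1 ≤ m) {δ : ℝ} (hδ : 0 < δ)
    (hδμ : δ < μ) (hμ : μ < 1) :
    ∃ E : Set Ω, MeasurableSet E ∧
      P.real E ≤ 1 / explorationRate t * Real.exp (-(m * (2 * δ ^ 2))) ∧
      ∀ ω y, 0 < y → y ≤ 1 → sampleMean (fun i => X i ω) m ≤ y → g t y m ≤ μ - δ → ω ∈ E := by
  have hf : 0 < explorationRate t := by
    unfold explorationRate
    positivity
  have hm0 : (0 : ℝ) < m := by exact_mod_cast hm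
  have hq : μ - δ ∈ Set.Ioo (0 : ℝ) 1 := ⟨by linarith, by linarith⟩
  -- Every estimate that makes the index at most `μ - δ` lies in `B`. The event is that the sample
  -- mean is at most `max B`, a maximum that exists by compactness if `B` is nonempty.
  let B : Set ℝ :=
    {y | y ∈ Set.Ioc 0 (μ - δ) ∧ Real.log (explorationRate t) / m ≤ klReal y (μ - δ)}
  have hB : ∀ y, 0 < y → y ≤ 1 → g t y m ≤ μ - δ → y ∈ B := by
    intro y hy0 hy1 hg
    -- `DecisionExplores` says nothing at `y = 1`; monotonicity in the mean gives an index there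
    -- above some `z > μ - δ`.
    have hy1' : y < 1 := by
      refine lt_of_le_of_ne hy1 fun h => ?_
      subst h
      obtain ⟨z, hz1, hz2⟩ := exists_between hq.2
      have h1 := (hexpl z ⟨hq.1.trans hz1, hz2⟩ t ht m hm).1
      have h2 := hmono.mean t (by omega) m hm (a := z) (b := 1)
        ⟨(hq.1.trans hz1).le, hz2.le⟩ ⟨zero_le_one, le_rfl⟩ hz2.le
      dsimp only at h2
      linarith
    obtain ⟨h1, h2⟩ := hexpl y ⟨hy0, hy1'⟩ t ht m hm
    have hg1 : g t y m < 1 := by linarith [hq.2]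
    have h3 := h2 hg1
    rw [klBernoulli_eq_coe ⟨hy0.trans h1, hg1⟩, EReal.coe_le_coe_iff] at h3
    refine ⟨⟨hy0, h1.le.trans hg⟩, h3.trans ?_⟩
    have h4 := klReal_add_sq_le hy0 h1.le hg hq.2
    nlinarith [sq_nonneg (μ - δ - g t y m)]
  rcases B.eq_empty_or_nonempty with he | ⟨y0, hy0⟩
  · refine ⟨∅, MeasurableSet.empty, ?_, ?_⟩
    · rw [measureReal_empty]
      positivity
    · intro ω y h0 h1 _ hg
      have := hB y h0 h1 hg
      rw [he] at this
      exact this.elim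
  · have hcont : ContinuousOn (fun p => klReal p (μ - δ)) (Set.Icc y0 (μ - δ)) :=
      (continuousOn_klReal hq).mono fun z hz =>
        ⟨hy0.1.1.trans_le hz.1, hz.2.trans_lt hq.2⟩
    have hcomp : IsCompact (Set.Icc y0 (μ - δ) ∩
        (fun p => klReal p (μ - δ)) ⁻¹' Set.Ici (Real.log (explorationRate t) / m)) :=
      isCompact_Icc.of_isClosed_subset
        (hcont.preimage_isClosed_of_isClosed isClosed_Icc isClosed_Ici) Set.inter_subset_left
    obtain ⟨z, hz, hzmax⟩ := hcomp.exists_isGreatest ⟨y0, ⟨le_rfl, hy0.1.2⟩, hy0.2⟩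
    have hz0 : 0 < z := hy0.1.1.trans_le hz.1.1
    refine ⟨{ω | sampleMean (fun i => X i ω) m ≤ z},
      measurableSet_le (measurable_sampleMean hXm m) measurable_const, ?_, ?_⟩
    · refine (measure_sampleMean_le_le hXm hind h01 hmean hm hz0
        (by linarith [hz.1.2]) hμ).trans ?_
      -- The Chernoff exponent `m * klReal z μ` splits into `log f(t)` and `2mδ²`.
      have h1 := klReal_add_sq_le hz0 hz.1.2 (by linarith : μ - δ ≤ μ) hμ
      have h2 : Real.log (explorationRate t) / m ≤ klReal z (μ - δ) := hz.2
      rw [div_le_iff₀ hm0] at h2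
      rw [one_div, ← Real.exp_log (inv_pos.mpr hf), ← Real.exp_add, Real.log_inv]
      apply Real.exp_le_exp.mpr
      rw [show μ - (μ - δ) = δ by ring] at h1
      nlinarith
    · intro ω y h0 h1 hle hg
      have hyB := hB y h0 h1 hg
      show sampleMean (fun i => X i ω) m ≤ z
      rcases le_total y0 y with h | h
      · exact hle.trans (hzmax ⟨⟨h, hyB.1.2⟩, hyB.2⟩)
      · exact hle.trans (h.trans hz.1.1)

end Concentration

/-- Each term is at most `1 / log (t - 1) - 1 / log t`, since `1 / t ≤ log t - log (t - 1)`; the sum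
telescopes to at most `1 / log 2`. It can start at `3` because the index rule acts at times `t > K ≥
2`. -/
theorem sum_inv_explorationRate_le (n : ℕ) :
    ∑ t ∈ Finset.Icc 3 n, 1 / explorationRate t ≤ 2 := by
  have hlog2 := Real.log_two_gt_d9
  have hind : ∀ n : ℕ, ∑ t ∈ Finset.Icc 3 (n + 2), 1 / explorationRate t ≤
      1 / Real.log 2 - 1 / Real.log ((n + 2 : ℕ) : ℝ) := by
    intro n
    induction n with
    | zero => simp
    | succ n ih =>
      rw [show n + 1 + 2 = (n + 2) + 1 by omega, Finset.sum_Icc_succ_top (by omega)]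
      have hn : (2 : ℝ) ≤ ((n + 2 : ℕ) : ℝ) := by exact_mod_cast (by omega : 2 ≤ n + 2)
      have hcast : ((n + 2 + 1 : ℕ) : ℝ) = ((n + 2 : ℕ) : ℝ) + 1 := by push_cast; ring
      rw [explorationRate, hcast]
      set a : ℝ := ((n + 2 : ℕ) : ℝ)
      have ha : 0 < Real.log a := Real.log_pos (by linarith)
      have hab : Real.log a ≤ Real.log (a + 1) := Real.log_le_log (by linarith) (by linarith)
      have hb : 0 < Real.log (a + 1) := ha.trans_le hab
      have h1 : 1 / (a + 1) ≤ Real.log (a + 1) - Real.log a := by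
        have := Real.one_sub_inv_le_log_of_pos (x := (a + 1) / a) (by positivity)
        rw [Real.log_div (by linarith) (by linarith)] at this
        refine le_trans (le_of_eq ?_) this
        field_simp
        ring
      have h2 : 1 / (1 + (a + 1) * Real.log (a + 1) ^ 2) ≤
          1 / (a + 1) / Real.log (a + 1) ^ 2 := by
        rw [div_div]
        apply one_div_le_one_div_of_le (by positivity)
        linarith
      have h3 : 1 / (a + 1) / Real.log (a + 1) ^ 2 ≤
          1 / Real.log a - 1 / Real.log (a + 1) := by
        rw [div_sub_div _ _ ha.ne' hb.ne', div_le_div_iff₀ (by positivity) (by positivity)]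
        have h4 : 1 / (a + 1) * (Real.log a * Real.log (a + 1)) ≤
            (Real.log (a + 1) - Real.log a) * (Real.log (a + 1) * Real.log (a + 1)) :=
          mul_le_mul h1 (mul_le_mul_of_nonneg_right hab hb.le) (by positivity) (by linarith)
        nlinarith
      linarith
  have hbound : 1 / Real.log 2 ≤ 2 := by
    rw [div_le_iff₀ (by linarith)]
    linarith
  rcases Nat.lt_or_ge n 2 with h | h
  · rw [Finset.Icc_eq_empty (by omega)]
    simp
  · obtain ⟨j, rfl⟩ := Nat.exists_eq_add_of_le' h
    have h1 := hind j
    have h2 : 0 ≤ 1 / Real.log ((j + 2 : ℕ) : ℝ) :=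
      one_div_nonneg.mpr (Real.log_natCast_nonneg _)
    linarith

/-! ### Counting pulls -/

theorem pullCount_le_self {K : ℕ} (pa : ArmPolicy K) (pm : MessagePolicy) (x : Fin K → ℕ → ℝ)
    (k : Fin K) (n : ℕ) : pullCount pa pm x k n ≤ n := by
  simpa [pullCount] using Finset.card_filter_le (Finset.Icc 1 n) fun t => broadcast pa pm x t = k

/-- Makes `t ↦ T_k(t - 1)` injective on the broadcast times of `k`, so that times can be counted by
pull numbers. -/
theorem pullCount_lt_of_broadcast_eq {K : ℕ} (pa : ArmPolicy K) (pm : MessagePolicy)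
    (x : Fin K → ℕ → ℝ) {k : Fin K} {t u : ℕ} (ht : 1 ≤ t) (htu : t < u)
    (hk : broadcast pa pm x t = k) :
    pullCount pa pm x k (t - 1) < pullCount pa pm x k (u - 1) := by
  apply Finset.card_lt_card
  rw [Finset.ssubset_iff_of_subset
    (Finset.filter_subset_filter _ (Finset.Icc_subset_Icc_right (by omega)))]
  refine ⟨t, Finset.mem_filter.mpr ⟨Finset.mem_Icc.mpr ⟨ht, by omega⟩, hk⟩, ?_⟩
  simp only [Finset.mem_filter, Finset.mem_Icc]
  omega

theorem IsIndexPolicy.one_le_pullCount {K : ℕ} {g : ℕ → ℝ → ℕ → ℝ} {pa : ArmPolicy K}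
    (hpa : IsIndexPolicy g pa) (pm : MessagePolicy) (x : Fin K → ℕ → ℝ) (k : Fin K) {n : ℕ}
    (hn : K ≤ n) : 1 ≤ pullCount pa pm x k n := by
  apply Finset.card_pos.mpr
  have h := hpa.1 (k + 1) (by omega) (by omega) (history pa pm x k)
  exact ⟨k + 1, Finset.mem_filter.mpr ⟨Finset.mem_Icc.mpr ⟨by omega, by omega⟩,
    Fin.ext (by simpa [broadcast] using h)⟩⟩

open Classical in
/-- Apart from its first broadcast, an arm is broadcast because the index of another arm has
fallen to `q` or because its own index exceeds `q`. -/
theorem IsIndexPolicy.pullCount_le {K : ℕ} {g : ℕ → ℝ → ℕ → ℝ} {pa : ArmPolicy K}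
    (hpa : IsIndexPolicy g pa) (hmono : DecisionMonotone g) {x : Fin K → ℕ → ℝ}
    (hx : ∀ k i, x k i ∈ Set.Icc (0 : ℝ) 1) (j k : Fin K) (q : ℝ) (n : ℕ) :
    pullCount pa messagePolicy x k n ≤ 1 +
      ((Finset.Icc (K + 1) n).filter fun t =>
        ∃ s, 1 ≤ s ∧ s ≤ n ∧ g t (estimate (x j) s) (sampleSize s) ≤ q).card +
      ((Finset.Icc 1 n).filter fun s => q < g n (estimate (x k) s) (sampleSize s)).card := by
  set T := fun i t => pullCount pa messagePolicy x i t with hT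
  -- All possible values `s` of the random pull count of `j` are allowed.
  set bad := (Finset.Icc (K + 1) n).filter fun t =>
    ∃ s, 1 ≤ s ∧ s ≤ n ∧ g t (estimate (x j) s) (sampleSize s) ≤ q
  set own := (Finset.Icc (K + 1) n).filter fun t => broadcast pa messagePolicy x t = k ∧
    q < g n (estimate (x k) (T k (t - 1))) (sampleSize (T k (t - 1))) with hown
  have hindex : ∀ t, K < t → ∀ i : Fin K, g t (estimate (x i) (T i (t - 1)))
      (sampleSize (T i (t - 1))) ≤
      g t (estimate (x (broadcast pa messagePolicy x t))
        (T (broadcast pa messagePolicy x t) (t - 1)))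
        (sampleSize (T (broadcast pa messagePolicy x t) (t - 1))) := by
    intro t ht i
    have h := hpa.2 t ht (history pa messagePolicy x (t - 1)) i
    simp only [history_messagePolicy, List.length_map, List.length_range] at h
    exact h
  have hTn : ∀ t ∈ Finset.Icc (K + 1) n, ∀ i, T i (t - 1) ∈ Finset.Icc 1 n := by
    intro t ht i
    have ht' := Finset.mem_Icc.mp ht
    have := pullCount_le_self pa messagePolicy x i (t - 1)
    exact Finset.mem_Icc.mpr ⟨hpa.one_le_pullCount _ _ _ (by omega), by simp only [hT]; omega⟩
  have hsub : ((Finset.Icc 1 n).filter fun t => broadcast pa messagePolicy x t = k) ⊆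
      {(k : ℕ) + 1} ∪ bad ∪ own := by
    intro t ht
    obtain ⟨ht1, htk⟩ := Finset.mem_filter.mp ht
    have ht1' := Finset.mem_Icc.mp ht1
    rcases Nat.lt_or_ge K t with hKt | hKt
    · have htI : t ∈ Finset.Icc (K + 1) n := Finset.mem_Icc.mpr ⟨hKt, ht1'.2⟩
      by_cases hj : g t (estimate (x j) (T j (t - 1))) (sampleSize (T j (t - 1))) ≤ q
      · refine Finset.mem_union_left _ (Finset.mem_union_right _ ?_)
        rw [Finset.mem_filter]
        exact ⟨htI, _, (Finset.mem_Icc.mp (hTn t htI j)).1, (Finset.mem_Icc.mp (hTn t htI j)).2, hj⟩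
      · refine Finset.mem_union_right _ (Finset.mem_filter.mpr ⟨htI, htk, ?_⟩)
        have h1 := hindex t hKt j
        rw [htk] at h1
        have hb := estimate_bounds (hx k) (Finset.mem_Icc.mp (hTn t htI k)).1
        -- Raising the time to `n` leaves a condition on the pull number alone.
        have h2 := hmono.time _ ⟨hb.1.le, hb.2.1⟩ _ (one_le_sampleSize (T k (t - 1)))
          (a := t) (b := n) (Set.mem_Ici.mpr ht1'.1) (Set.mem_Ici.mpr (ht1'.1.trans ht1'.2))
          ht1'.2
        exact (not_le.mp hj).trans_le (h1.trans h2)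
    · have h := hpa.1 t ht1'.1 hKt (history pa messagePolicy x (t - 1))
      have hk : pa t (history pa messagePolicy x (t - 1)) = k := htk
      rw [hk] at h
      exact Finset.mem_union_left _ (Finset.mem_union_left _ (Finset.mem_singleton.mpr h.symm))
  have hcard : own.card ≤
      ((Finset.Icc 1 n).filter fun s => q < g n (estimate (x k) s) (sampleSize s)).card := by
    apply Finset.card_le_card_of_injOn fun t => T k (t - 1)
    · intro t ht
      obtain ⟨h1, _, h2⟩ := Finset.mem_filter.mp ht
      exact Finset.mem_filter.mpr ⟨hTn t h1 k, h2⟩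
    · intro t ht u hu htu
      obtain ⟨ht1, ht2, _⟩ := Finset.mem_filter.mp ht
      obtain ⟨hu1, hu2, _⟩ := Finset.mem_filter.mp hu
      have ht1' := Finset.mem_Icc.mp ht1
      have hu1' := Finset.mem_Icc.mp hu1
      change pullCount pa messagePolicy x k (t - 1) = pullCount pa messagePolicy x k (u - 1) at htu
      rcases lt_trichotomy t u with h | h | h
      · have := pullCount_lt_of_broadcast_eq pa messagePolicy x (by omega) h ht2
        omega
      · exact h
      · have := pullCount_lt_of_broadcast_eq pa messagePolicy x (by omega) h hu2
        omega
  calc pullCount pa messagePolicy x k n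
      ≤ ({(k : ℕ) + 1} ∪ bad ∪ own).card := Finset.card_le_card hsub
    _ ≤ ({(k : ℕ) + 1} ∪ bad).card + own.card := Finset.card_union_le _ _
    _ ≤ 1 + bad.card + own.card := by
        have := Finset.card_union_le {(k : ℕ) + 1} bad
        rw [Finset.card_singleton] at this
        omega
    _ ≤ _ := by omega

/-- With enough samples, the index of an arm exceeds `x₂` only if its sample mean is too large. -/
theorem le_sampleMean_of_lt_index {g : ℕ → ℝ → ℕ → ℝ} (hmono : DecisionMonotone g)
    (hconv : DecisionConverges g) {x : ℕ → ℝ} (hx : ∀ i, x i ∈ Set.Icc (0 : ℝ) 1) {n s : ℕ}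
    (hn : 1 ≤ n) (hs : 1 ≤ s) {μ δ x₂ : ℝ} (hδ : 0 < δ) (h₁ : 0 < μ + δ) (h₁₂ : μ + δ < x₂)
    (h₂ : x₂ < 1) (hfall : (fallTime g n (μ + δ) x₂ : ℝ) ≤ sampleSize s)
    (hsize : 4 / δ ^ 2 ≤ sampleSize s) (hg : x₂ < g n (estimate x s) (sampleSize s)) :
    μ + δ / 2 ≤ sampleMean x (sampleSize s) := by
  by_contra! hlt
  obtain ⟨hb0, hb1, _, hb⟩ := estimate_bounds hx hs
  have hsq : (sampleSize s : ℝ) ≤ ((packetCount s : ℝ) + 1) ^ 2 := by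
    exact_mod_cast sampleSize_le_sq hs
  have h2δ : 2 / δ ≤ (packetCount s : ℝ) + 1 := by
    apply le_of_sq_le_sq _ (by positivity)
    rw [div_pow]
    norm_num
    exact hsize.trans hsq
  have hinv : 1 / ((packetCount s : ℝ) + 1) ≤ δ / 2 := by
    rw [div_le_iff₀ hδ] at h2δ
    rw [div_le_div_iff₀ (by positivity) (by norm_num)]
    linarith
  have hest : estimate x s ≤ μ + δ := by linarith
  have hmem : μ + δ ∈ Set.Icc (0 : ℝ) 1 := ⟨h₁.le, by linarith⟩
  obtain ⟨hS1, hS2⟩ := (fallTime_isLeast hconv hn h₁ h₁₂ h₂).1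
  have h3 := hmono.mean n hn (sampleSize s) (one_le_sampleSize s) ⟨hb0.le, hb1⟩ hmem hest
  have h4 := hmono.pulls n hn (μ + δ) hmem (Set.mem_Ici.mpr hS1)
    (Set.mem_Ici.mpr (one_le_sampleSize s)) (by exact_mod_cast hfall)
  dsimp only at h3 h4
  linarith

/-! ### Expected number of pulls -/

theorem card_filter_mem_eq_sum_indicator {ι Ω : Type*} (s : Finset ι) (A : ι → Set Ω) (ω : Ω)
    [DecidablePred fun i => ω ∈ A i] :
    ((s.filter fun i => ω ∈ A i).card : ℝ) = ∑ i ∈ s, (A i).indicator (fun _ => (1 : ℝ)) ω := by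
  rw [Finset.card_filter]
  push_cast
  apply Finset.sum_congr rfl
  intro i _
  by_cases h : ω ∈ A i <;> simp [h]

section Expectation

variable {K : ℕ} {Ω : Type*} [MeasurableSpace Ω] {P : Measure Ω} [IsProbabilityMeasure P]

/-- The pull count of arm `k` compared with a better arm `j`. -/
theorem integral_pullCount_le (hK : 2 ≤ K) {X : Fin K → ℕ → Ω → ℝ}
    (hXm : ∀ k i, Measurable (X k i)) (hind : ∀ k, iIndepFun (X k) P)
    (h01 : ∀ k i, ∀ᵐ ω ∂P, X k i ω ∈ Set.Icc (0 : ℝ) 1) {μ : Fin K → ℝ}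
    (hmean : ∀ k i, P[X k i] = μ k) {g : ℕ → ℝ → ℕ → ℝ} (hmono : DecisionMonotone g)
    (hconv : DecisionConverges g) (hexpl : DecisionExplores g) {pa : ArmPolicy K}
    (hpa : IsIndexPolicy g pa) {n : ℕ} (hn : 1 ≤ n) {j k : Fin K} (hk : 0 < μ k)
    (hj : μ j < 1) {δ : ℝ} (hδ : 0 < δ) (hδ2 : δ < (μ j - μ k) / 2) {y : ℝ}
    (hy : y = max (fallTime g n (μ k + δ) (μ j - δ) : ℝ) (4 / δ ^ 2)) :
    ∫ ω, (pullCount pa messagePolicy (fun i l => X i l ω) k n : ℝ) ∂P ≤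
      y + 3 * Real.logb 2 y + 6 / δ ^ 2 := by
  classical
  have hyS : (fallTime g n (μ k + δ) (μ j - δ) : ℝ) ≤ y := hy ▸ le_max_left _ _
  have hyδ : 4 / δ ^ 2 ≤ y := hy ▸ le_max_right _ _
  have hy16 : 16 ≤ y := by
    refine le_trans ?_ hyδ
    rw [le_div_iff₀ (by positivity)]
    nlinarith
  -- Padding with the empty set outside `t ≥ 2`, `m ≥ 1` makes the family total, so that `choose`
  -- applies.
  have hE : ∀ t m : ℕ, ∃ E : Set Ω, MeasurableSet E ∧ (2 ≤ t → 1 ≤ m →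
      P.real E ≤ 1 / explorationRate t * Real.exp (-(m * (2 * δ ^ 2))) ∧
      ∀ ω z, 0 < z → z ≤ 1 → sampleMean (fun i => X j i ω) m ≤ z → g t z m ≤ μ j - δ →
        ω ∈ E) := by
    intro t m
    by_cases h : 2 ≤ t ∧ 1 ≤ m
    · obtain ⟨E, h1, h2⟩ := exists_event_underestimate (hXm j) (hind j) (h01 j) (hmean j) hmono
        hexpl h.1 h.2 hδ (by linarith) hj
      exact ⟨E, h1, fun _ _ => h2⟩
    · exact ⟨∅, MeasurableSet.empty, fun h1 h2 => (h ⟨h1, h2⟩).elim⟩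
  choose E hEm hE using hE
  let F : ℕ → Set Ω := fun s => {ω | μ k + δ / 2 ≤ sampleMean (fun i => X k i ω) (sampleSize s)}
  have hFm : ∀ s, MeasurableSet (F s) := fun s =>
    measurableSet_le measurable_const (measurable_sampleMean (hXm k) _)
  let few := (Finset.Icc 1 n).filter fun s => (sampleSize s : ℝ) < y
  let many := (Finset.Icc 1 n).filter fun s => y ≤ (sampleSize s : ℝ)
  let B : Ω → ℝ := fun ω =>
    1 + ∑ t ∈ Finset.Icc (K + 1) n, ∑ m ∈ Finset.Icc 1 n,
      (E t m).indicator (fun _ => (1 : ℝ)) ω +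
    (few.card + ∑ s ∈ many, (F s).indicator (fun _ => (1 : ℝ)) ω)
  have hindE : ∀ t m, Integrable ((E t m).indicator fun _ => (1 : ℝ)) P := fun t m =>
    (integrable_const _).indicator (hEm t m)
  have hindF : ∀ s, Integrable ((F s).indicator fun _ => (1 : ℝ)) P := fun s =>
    (integrable_const _).indicator (hFm s)
  have hintE : Integrable (fun ω => ∑ t ∈ Finset.Icc (K + 1) n, ∑ m ∈ Finset.Icc 1 n,
      (E t m).indicator (fun _ => (1 : ℝ)) ω) P :=
    integrable_finsetSum _ fun t _ => integrable_finsetSum _ fun m _ => hindE t m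
  have hintF : Integrable (fun ω => ∑ s ∈ many, (F s).indicator (fun _ => (1 : ℝ)) ω) P :=
    integrable_finsetSum _ fun s _ => hindF s
  have hintE1 : Integrable (fun ω => 1 + ∑ t ∈ Finset.Icc (K + 1) n, ∑ m ∈ Finset.Icc 1 n,
      (E t m).indicator (fun _ => (1 : ℝ)) ω) P := (integrable_const _).add hintE
  have hintF1 : Integrable (fun ω => few.card +
      ∑ s ∈ many, (F s).indicator (fun _ => (1 : ℝ)) ω) P := (integrable_const _).add hintF
  have hBint : Integrable B P := hintE1.add hintF1
  have hle : ∀ᵐ ω ∂P, (pullCount pa messagePolicy (fun i l => X i l ω) k n : ℝ) ≤ B ω := by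
    filter_upwards [ae_all_iff.mpr fun i => ae_all_iff.mpr (h01 i)] with ω hω
    have hcount := hpa.pullCount_le hmono hω j k (μ j - δ) n
    have hbad : (((Finset.Icc (K + 1) n).filter fun t => ∃ s, 1 ≤ s ∧ s ≤ n ∧
        g t (estimate (fun i => X j i ω) s) (sampleSize s) ≤ μ j - δ).card : ℝ) ≤
        ∑ t ∈ Finset.Icc (K + 1) n, ∑ m ∈ Finset.Icc 1 n,
          (E t m).indicator (fun _ => (1 : ℝ)) ω := by
      rw [Finset.card_filter]
      push_cast
      apply Finset.sum_le_sum
      intro t ht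
      have hnn : ∀ m ∈ Finset.Icc 1 n, 0 ≤ (E t m).indicator (fun _ => (1 : ℝ)) ω :=
        fun m _ => Set.indicator_nonneg (fun _ _ => zero_le_one) ω
      split_ifs with h
      · obtain ⟨s, hs1, hsn, hg⟩ := h
        have hb := estimate_bounds (hω j) hs1
        have ht2 : 2 ≤ t := by
          have := (Finset.mem_Icc.mp ht).1
          omega
        have hmem : ω ∈ E t (sampleSize s) :=
          (hE t (sampleSize s) ht2 (one_le_sampleSize s)).2 ω _ hb.1 hb.2.1 hb.2.2.1 hg
        have hsz : sampleSize s ∈ Finset.Icc 1 n :=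
          Finset.mem_Icc.mpr ⟨one_le_sampleSize s, (sampleSize_le hs1).trans hsn⟩
        refine le_trans ?_ (Finset.single_le_sum hnn hsz)
        rw [Set.indicator_of_mem hmem]
      · exact Finset.sum_nonneg hnn
    have hown : (((Finset.Icc 1 n).filter fun s =>
        μ j - δ < g n (estimate (fun i => X k i ω) s) (sampleSize s)).card : ℝ) ≤
        few.card + ∑ s ∈ many, (F s).indicator (fun _ => (1 : ℝ)) ω := by
      rw [← card_filter_mem_eq_sum_indicator]
      have hsub : ((Finset.Icc 1 n).filter fun s =>
          μ j - δ < g n (estimate (fun i => X k i ω) s) (sampleSize s)) ⊆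
          few ∪ many.filter fun s => ω ∈ F s := by
        intro s hs
        obtain ⟨hs1, hs2⟩ := Finset.mem_filter.mp hs
        rcases lt_or_ge (sampleSize s : ℝ) y with h | h
        · exact Finset.mem_union_left _ (Finset.mem_filter.mpr ⟨hs1, h⟩)
        · refine Finset.mem_union_right _ (Finset.mem_filter.mpr
            ⟨Finset.mem_filter.mpr ⟨hs1, h⟩, ?_⟩)
          exact le_sampleMean_of_lt_index hmono hconv (hω k) hn (Finset.mem_Icc.mp hs1).1 hδ
            (by linarith) (by linarith) (by linarith) (hyS.trans h) (hyδ.trans h) hs2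
      exact_mod_cast (Finset.card_le_card hsub).trans (Finset.card_union_le _ _)
    have hcount' : (pullCount pa messagePolicy (fun i l => X i l ω) k n : ℝ) ≤ 1 +
        (((Finset.Icc (K + 1) n).filter fun t => ∃ s, 1 ≤ s ∧ s ≤ n ∧
          g t (estimate (fun i => X j i ω) s) (sampleSize s) ≤ μ j - δ).card : ℝ) +
        (((Finset.Icc 1 n).filter fun s =>
          μ j - δ < g n (estimate (fun i => X k i ω) s) (sampleSize s)).card : ℝ) := by
      exact_mod_cast hcount
    simp only [B]
    linarith
  have hmonoInt := integral_mono_of_nonneg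
    (Filter.Eventually.of_forall fun ω => Nat.cast_nonneg _) hBint hle
  have hB : ∫ ω, B ω ∂P = 1 + ∑ t ∈ Finset.Icc (K + 1) n, ∑ m ∈ Finset.Icc 1 n, P.real (E t m) +
      (few.card + ∑ s ∈ many, P.real (F s)) := by
    simp only [B]
    rw [integral_add hintE1 hintF1,
      integral_add (integrable_const _) hintE, integral_add (integrable_const _) hintF,
      integral_finsetSum _ fun s _ => hindF s,
      integral_finsetSum _ fun t _ => integrable_finsetSum _ fun m _ => hindE t m]
    simp_rw [integral_finsetSum _ fun m _ => hindE _ m]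
    simp [integral_indicator_const, hEm, hFm]
  have hEsum : ∑ t ∈ Finset.Icc (K + 1) n, ∑ m ∈ Finset.Icc 1 n, P.real (E t m) ≤
      1 / δ ^ 2 := by
    have hrate : ∀ t : ℕ, 0 < 1 / explorationRate t := by
      intro t
      unfold explorationRate
      positivity
    calc ∑ t ∈ Finset.Icc (K + 1) n, ∑ m ∈ Finset.Icc 1 n, P.real (E t m)
        ≤ ∑ t ∈ Finset.Icc (K + 1) n, ∑ m ∈ Finset.Icc 1 n,
            1 / explorationRate t * Real.exp (-(m * (2 * δ ^ 2))) := by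
          refine Finset.sum_le_sum fun t ht => Finset.sum_le_sum fun m hm => ?_
          have := (Finset.mem_Icc.mp ht).1
          exact (hE t m (by omega) (Finset.mem_Icc.mp hm).1).1
      _ = (∑ t ∈ Finset.Icc (K + 1) n, 1 / explorationRate t) *
            ∑ m ∈ Finset.Icc 1 n, Real.exp (-(m * (2 * δ ^ 2))) := by
          rw [Finset.sum_mul_sum]
      _ ≤ 2 * (1 / (2 * δ ^ 2)) := by
          apply mul_le_mul _ (sum_exp_neg_mul_le n (by positivity))
            (Finset.sum_nonneg fun _ _ => (Real.exp_pos _).le) (by norm_num)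
          exact (Finset.sum_le_sum_of_subset_of_nonneg
            (Finset.Icc_subset_Icc_left (by omega)) fun t _ _ => (hrate t).le).trans
            (sum_inv_explorationRate_le n)
      _ = 1 / δ ^ 2 := by
          field_simp
  have hFsum : ∑ s ∈ many, P.real (F s) ≤ 4 / δ ^ 2 := by
    calc ∑ s ∈ many, P.real (F s)
        ≤ ∑ s ∈ many, Real.exp (-(sampleSize s * (δ ^ 2 / 2))) := by
          refine Finset.sum_le_sum fun s _ => ?_
          refine (measure_le_sampleMean_le (hXm k) (hind k) (h01 k) (hmean k)
            (one_le_sampleSize s) (ε := δ / 2) (by positivity)).trans_eq ?_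
          congr 2
          ring
      _ ≤ ∑ s ∈ (Finset.Icc 1 n).filter (fun s => 2 ≤ packetCount s),
            Real.exp (-(sampleSize s * (δ ^ 2 / 2))) := by
          refine Finset.sum_le_sum_of_subset_of_nonneg ?_ fun _ _ _ => (Real.exp_pos _).le
          intro s hs
          obtain ⟨hs1, hs2⟩ := Finset.mem_filter.mp hs
          refine Finset.mem_filter.mpr ⟨hs1, ?_⟩
          by_contra hlt
          -- With fewer than two packets the sample size is `1`, below `y ≥ 16`.
          have h0 : packetCount s - 1 = 0 := by omega
          rw [sampleSize, h0, packetEnd_zero] at hs2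
          norm_num at hs2
          linarith
      _ ≤ 2 / (δ ^ 2 / 2) := sum_exp_neg_sampleSize_le n (by positivity)
      _ = 4 / δ ^ 2 := by
          field_simp
          norm_num
  have hfew := card_sampleSize_lt_le n (y := y) (by linarith)
  -- The constants `1` (initial broadcast) and `2` (from `hfew`) are absorbed by the third `log₂ y`.
  have hlog : 4 ≤ Real.logb 2 y := by
    rw [Real.le_logb_iff_rpow_le (by norm_num) (by linarith)]
    norm_num
    exact hy16
  have hδ6 : 6 / δ ^ 2 = 1 / δ ^ 2 + 4 / δ ^ 2 + 1 / δ ^ 2 := by ring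
  have hδ1 : 0 < 1 / δ ^ 2 := by positivity
  rw [hB] at hmonoInt
  have hfew' : (few.card : ℝ) ≤ y + 2 * Real.logb 2 y + 2 := hfew
  linarith

/-! ### From pull counts to regret. -/

theorem regret_eq_sum [NeZero K] (ν : Fin K → Measure ℝ) {X : Fin K → ℕ → Ω → ℝ}
    (hXm : ∀ k i, Measurable (X k i)) (pa : ArmPolicy K) (n : ℕ) :
    regret P ν X pa messagePolicy n = ∑ k ∈ Finset.univ.erase (0 : Fin K), gap ν k *
      ∫ ω, (pullCount pa messagePolicy (fun i l => X i l ω) k n : ℝ) ∂P := by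
  classical
  let A : Fin K → ℕ → Set Ω := fun k t =>
    {ω | broadcast pa messagePolicy (fun i l => X i l ω) t = k}
  have hA : ∀ k t, MeasurableSet (A k t) := fun k t =>
    measurable_broadcast pa hXm t (measurableSet_singleton k)
  have hint : ∀ k t, Integrable ((A k t).indicator fun _ => (1 : ℝ)) P := fun k t =>
    (integrable_const _).indicator (hA k t)
  have hcount : ∀ k, ∫ ω, (pullCount pa messagePolicy (fun i l => X i l ω) k n : ℝ) ∂P =
      ∑ t ∈ Finset.Icc 1 n, P.real (A k t) := by
    intro k
    have h : ∀ ω, (pullCount pa messagePolicy (fun i l => X i l ω) k n : ℝ) =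
        ∑ t ∈ Finset.Icc 1 n, (A k t).indicator (fun _ => (1 : ℝ)) ω := by
      intro ω
      rw [← card_filter_mem_eq_sum_indicator]
      rfl
    simp_rw [h]
    rw [integral_finsetSum _ fun t _ => hint k t]
    simp [integral_indicator_const, hA]
  have hstep : ∀ t, ∫ ω, (armMean ν 0 - armMean ν
      (broadcast pa messagePolicy (fun i l => X i l ω) t)) ∂P =
      ∑ k ∈ Finset.univ.erase (0 : Fin K), gap ν k * P.real (A k t) := by
    intro t
    have h : ∀ ω, armMean ν 0 - armMean ν (broadcast pa messagePolicy (fun i l => X i l ω) t) =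
        ∑ k ∈ Finset.univ.erase (0 : Fin K),
          gap ν k * (A k t).indicator (fun _ => (1 : ℝ)) ω := by
      intro ω
      rw [Finset.sum_erase _ (by simp [gap]),
        Finset.sum_eq_single (broadcast pa messagePolicy (fun i l => X i l ω) t)]
      · simp [A, gap]
      · intro k _ hk
        simp [A, Ne.symm hk]
      · simp
    simp_rw [h]
    rw [integral_finsetSum _ fun k _ => (hint k t).const_mul _]
    refine Finset.sum_congr rfl fun k _ => ?_
    rw [integral_const_mul]
    simp [integral_indicator_const, hA]
  rw [regret, Finset.sum_congr rfl fun t _ => hstep t, Finset.sum_comm]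
  refine Finset.sum_congr rfl fun k _ => ?_
  rw [hcount, Finset.mul_sum]

end Expectation

end LeaderFollower

theorem lemma1 {K : ℕ} [NeZero K] (hK : 2 ≤ K)
    {Ω : Type*} [MeasurableSpace Ω] (P : Measure Ω) [IsProbabilityMeasure P]
    -- reward distributions on `[0, 1]`, with sorted means and a unique best arm
    (ν : Fin K → Measure ℝ) (hν : ∀ k, ∀ᵐ y ∂(ν k), y ∈ Set.Icc (0 : ℝ) 1)
    (hpos : ∀ k, 0 < armMean ν k) (hsorted : Antitone (armMean ν))
    (hbest : ∀ k, k ≠ 0 → armMean ν k < armMean ν 0) (hlt : armMean ν 0 < 1)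
    -- for each arm, i.i.d. rewards
    (X : Fin K → ℕ → Ω → ℝ) (hXm : ∀ k i, Measurable (X k i))
    (hXlaw : ∀ k i, P.map (X k i) = ν k) (hXind : ∀ k, iIndepFun (X k) P)
    -- the decision function and the arm policy based on it
    (g : ℕ → ℝ → ℕ → ℝ) (hmono : DecisionMonotone g) (hconv : DecisionConverges g)
    (hexpl : DecisionExplores g)
    (pa : ArmPolicy K) (hpa : IsIndexPolicy g pa)
    (n : ℕ) (hn : 1 ≤ n) :
    (regret P ν X pa messagePolicy n ≤
      ∑ k ∈ Finset.univ.erase (0 : Fin K), gap ν k *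
        ⨅ δ : Set.Ioo (0 : ℝ) (gap ν k / 2),
          ((fallTime g n (armMean ν k + δ) (armMean ν 0 - δ) : ℝ)
            + 3 * Real.logb 2
                (max (fallTime g n (armMean ν k + δ) (armMean ν 0 - δ) : ℝ) (4 / (δ : ℝ) ^ 2))
            + 10 / (δ : ℝ) ^ 2)) ∧
    ∀ k : Fin K, k ≠ 0 → ∀ δ ∈ Set.Ioo (0 : ℝ) (gap ν k / 2),
      ∫ ω, (pullCount pa messagePolicy (fun j i => X j i ω) k n : ℝ) ∂P ≤
        max (fallTime g n (armMean ν k + δ) (armMean ν 0 - δ) : ℝ) (4 / δ ^ 2)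
          + 3 * Real.logb 2
              (max (fallTime g n (armMean ν k + δ) (armMean ν 0 - δ) : ℝ) (4 / δ ^ 2))
          + 6 / δ ^ 2 := by
  have h01 : ∀ k i, ∀ᵐ ω ∂P, X k i ω ∈ Set.Icc (0 : ℝ) 1 := fun k i =>
    ae_of_ae_map (hXm k i).aemeasurable ((hXlaw k i).symm ▸ hν k)
  have hmean : ∀ k i, P[X k i] = armMean ν k := by
    intro k i
    rw [armMean, ← hXlaw k i]
    exact (integral_map (hXm k i).aemeasurable aestronglyMeasurable_id).symm
  have hpull : ∀ k : Fin K, k ≠ 0 → ∀ δ ∈ Set.Ioo (0 : ℝ) (gap ν k / 2), _ :=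
    fun k _ δ hδ => integral_pullCount_le hK hXm hXind h01 hmean hmono hconv hexpl hpa hn
      (j := 0) (k := k) (hpos k) hlt hδ.1 hδ.2 rfl
  refine ⟨?_, hpull⟩
  rw [regret_eq_sum ν hXm pa n]
  refine Finset.sum_le_sum fun k hk => ?_
  have hk0 : k ≠ 0 := Finset.ne_of_mem_erase hk
  have hgap : 0 < gap ν k := sub_pos.mpr (hbest k hk0)
  have : Nonempty (Set.Ioo (0 : ℝ) (gap ν k / 2)) :=
    (Set.nonempty_Ioo.mpr (by linarith)).to_subtype
  refine mul_le_mul_of_nonneg_left (le_ciInf fun δ => ?_) hgap.le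
  refine (hpull k hk0 δ δ.2).trans ?_
  have hδ : 0 < (δ : ℝ) := δ.2.1
  -- Bounding the maximum by the sum turns `6/δ²` into `10/δ²`; inside the logarithm the maximum is
  -- kept.
  have hmax : max (fallTime g n (armMean ν k + δ) (armMean ν 0 - δ) : ℝ) (4 / (δ : ℝ) ^ 2) ≤
      fallTime g n (armMean ν k + δ) (armMean ν 0 - δ) + 4 / (δ : ℝ) ^ 2 :=
    max_le (le_add_of_nonneg_right (by positivity)) (le_add_of_nonneg_left (by positivity))
  have hsplit : 10 / (δ : ℝ) ^ 2 = 4 / (δ : ℝ) ^ 2 + 6 / (δ : ℝ) ^ 2 := by ring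
  linarith
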